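/- Let $G$ be a finitely generated virtually nilpotent group with a finite generating set $S$ that contains the identity and is closed under inverses. Let $d_S(x,y)$ be the word metric (the least $n\ge 0$ such that $x^{-1}y$ is a product of $n$ elements of $S$), let $B(g,n)=\{h : d_S(g,h)\le n\}$ be the closed ball and $S(g,n)=\{h: d_S(g,h)=n\}$ the sphere. Let $d$ be the degree of polynomial growth of $G$, that is, the least $d\in\{0,1,2,\dots\}$ for which there is $C>0$ with $|B(e,n)|\le Cn^d$ for all $n\ge 1$. Assume that $(G,S)$ has the small sphere property: there is a constant $c'$ with $|S(g,n)|\le c'n^{d-1}$ for all $n\ge 1$ and $g\in G$. Let ${}^*$ denote nonstandard extensions, formed as ultrapowers by an ultrafilter on an arbitrary index set; an internal subset of ${}^*G$ is an element of ${}^*\mathcal P(G)$, regarded as a subset of ${}^*G$. An infinite hyperfinite ball is an internal ball $I=B(g,N)$ with $g\in{}^*G$ and $N\in{}^*\mathbb N\setminus\mathbb N$. For such $I$ and an internal set $A\subseteq{}^*G$: * let $\operatorname{eq}_N(x)$ be the class of $x\in{}^*G$ under the relation $x\sim_N y$ iff $d_S(x,y)/N$ is infinitesimal, and put $\lambda_I(A)=\mu_{g,N}\big(\operatorname{eq}_N^{-1}(\operatorname{eq}_N(A\cap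 I))\cap I\big)$, where $\mu_{g,N}$ is the Loeb measure of the hyperfinite set $I$, that is, the Carathéodory extension of $C\mapsto\operatorname{st}(|C|/|I|)$ on internal $C\subseteq I$; * let $g_A(I)=\max\{|B(x,M)|/|I| : B(x,M)\subseteq I,\ B(x,M)\cap A=\emptyset\}$, where $x\in{}^*G$, $M\in{}^*\mathbb N$ (and $g_A(I)=0$ if there is no such ball). Say that $A$ has the BM property on $I$ if for every real $\varepsilon>0$ there is a real $\delta>0$ such that $\lambda_J(A)\ge 1-\varepsilon$ for every infinite hyperfinite ball $J\subseteq I$ with $g_A(J)\le\delta$. Say that $A$ has the enhanced BM property on $I$ if it has the BM property on $I$ and $\lambda_I(A)>0$. **Theorem.** Let $A$ be an internal subset of ${}^*G$ that has the enhanced BM property on an infinite hyperfinite ball $I$, and suppose that $A\cap I=B_1\cup\dots\cup B_n$ with each $B_i$ internal. Then there are $i\in\{1,\dots,n\}$ and an infinite hyperfinite ball $J\subseteq I$ such that $B_i$ has the enhanced BM property on $J$. -/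

import Mathlib

open Filter MeasureTheory
open scoped ENNReal

noncomputable section

namespace BallMeasure

/-! ### The word metric, balls, spheres and growth -/

section Standard

variable {G : Type*} [Group G]

/-- A finite generating set that contains the identity and is closed under inverses. -/
structure IsSymmGenSet (S : Set G) : Prop where
  finite : S.Finite
  one_mem : 1 ∈ S
  inv_mem : ∀ s ∈ S, s⁻¹ ∈ S
  closure_eq_top : Subgroup.closure S = ⊤

/-- The word length: the least length of a product of elements of `S` equal to `g`
(the empty product, of length `0`, is the identity). -/
def wordLength (S : Set G) (g : G) : ℕ :=
  sInf {n : ℕ | ∃ l : List G, (∀ s ∈ l, s ∈ S) ∧ l.length = n ∧ l.prod = g}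

/-- The word metric. -/
def wordDist (S : Set G) (x y : G) : ℕ := wordLength S (x⁻¹ * y)

/-- The closed ball `B(g, n)`. -/
def ball (S : Set G) (g : G) (n : ℕ) : Set G := {h | wordDist S g h ≤ n}

/-- The sphere `S(g, n)`; for `n ≥ 1` it is `B(g, n) \ B(g, n - 1)`. -/
def sphere (S : Set G) (g : G) (n : ℕ) : Set G := {h | wordDist S g h = n}

/-- `α_n ≤ C n ^ d` for some `C > 0` and all `n ≥ 1`. -/
def GrowthAtMost (S : Set G) (d : ℕ) : Prop :=
  ∃ C : ℝ, 0 < C ∧ ∀ n : ℕ, 1 ≤ n → ((ball S 1 n).ncard : ℝ) ≤ C * (n : ℝ) ^ d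

/-- `d` is the degree of polynomial growth. -/
def IsGrowthDegree (S : Set G) (d : ℕ) : Prop := IsLeast {k | GrowthAtMost S k} d

/-- The small sphere property: spheres of radius `n ≥ 1` have at most `c' n ^ (d - 1)` elements,
where `d` is the degree of polynomial growth. The exponent `d - 1` is an integer. -/
def SmallSphereProperty (S : Set G) : Prop :=
  ∃ d : ℕ, IsGrowthDegree S d ∧
    ∃ c' : ℝ, ∀ n : ℕ, 1 ≤ n → ∀ g : G,
      ((sphere S g n).ncard : ℝ) ≤ c' * (n : ℝ) ^ ((d : ℤ) - 1)

/-- The largest relative size `|B(x, m)| / |I|` of a ball contained in `I` and disjoint from `A`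
(`0` if there is no such ball). For finite `I` the supremum is a maximum over a finite set. -/
def gapRatio (S : Set G) (A I : Set G) : ℝ :=
  sSup {q : ℝ | ∃ (x : G) (m : ℕ), ball S x m ⊆ I ∧ ball S x m ∩ A = ∅ ∧
    q = ((ball S x m).ncard : ℝ) / (I.ncard : ℝ)}

end Standard

/-! ### Nonstandard extensions -/

section Nonstandard

variable {ι : Type*} {𝓤 : Ultrafilter ι}

/-- The nonstandard extension of `X`: the ultrapower by `𝓤`. -/
abbrev NS (𝓤 : Ultrafilter ι) (X : Type*) : Type _ := Germ (𝓤 : Filter ι) X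

/-- The set of points of the extension of `X` given by an element of the extension of the
powerset of `X`. The sets of this form are the internal sets. -/
def toSet {X : Type*} (A : NS 𝓤 (Set X)) : Set (NS 𝓤 X) :=
  {x | Germ.LiftRel (fun (a : X) (B : Set X) => a ∈ B) x A}

/-- A hypernatural number that is not a standard natural number. -/
def IsInfinite (N : NS 𝓤 ℕ) : Prop := ∀ n : ℕ, N ≠ (n : NS 𝓤 ℕ)

/-- A hypernatural number as a hyperreal number. -/
def natToReal (N : NS 𝓤 ℕ) : NS 𝓤 ℝ := N.map (fun n : ℕ => (n : ℝ))

/-- The internal cardinality of a hyperfinite set, as a hyperreal number. -/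
def internalCard {X : Type*} (A : NS 𝓤 (Set X)) : NS 𝓤 ℝ := natToReal (A.map Set.ncard)

/-- `st (|C ∩ I| / |I|)` for an internal set `C` and a hyperfinite set `I`. -/
def loebContent {X : Type*} (I C : NS 𝓤 (Set X)) : ℝ≥0∞ :=
  ENNReal.ofReal (ArchimedeanClass.stdPart
    (internalCard (Germ.map₂ (fun c i : Set X => c ∩ i) C I) / internalCard I))

/-- `loebContent I` as a function of the underlying set of points, with value `∞` on sets that are
not internal. (An internal set has only one representation.) -/
def loebContentSet {X : Type*} (I : NS 𝓤 (Set X)) (E : Set (NS 𝓤 X)) : ℝ≥0∞ :=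
  ⨅ (C : NS 𝓤 (Set X)) (_ : toSet C = E), loebContent I C

theorem loebContentSet_empty {X : Type*} (I : NS 𝓤 (Set X)) : loebContentSet I ∅ = 0 := by
  have h1 : toSet ((∅ : Set X) : NS 𝓤 (Set X)) = ∅ := by
    ext x
    induction x using Germ.inductionOn with
    | h f =>
      refine iff_of_false (fun h => ?_) (fun h => h)
      have h' : ∀ᶠ i in (𝓤 : Filter ι), f i ∈ (∅ : Set X) := h
      obtain ⟨i, hi⟩ := h'.exists
      exact hi
  have h2 : loebContent I ((∅ : Set X) : NS 𝓤 (Set X)) = 0 := by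
    induction I using Germ.inductionOn with
    | h f =>
      have h3 : internalCard (Germ.map₂ (fun c i : Set X => c ∩ i)
          ((∅ : Set X) : NS 𝓤 (Set X)) (f : NS 𝓤 (Set X))) = 0 := by
        change ((fun i => (((∅ : Set X) ∩ f i).ncard : ℝ) : ι → ℝ) : NS 𝓤 ℝ) = 0
        simp only [Set.empty_inter, Set.ncard_empty, Nat.cast_zero]
        rfl
      simp [loebContent, h3]
  refine le_antisymm ?_ bot_le
  exact (iInf₂_le ((∅ : Set X) : NS 𝓤 (Set X)) h1).trans h2.le

/-- The outer measure of the Carathéodory construction for `loebContent I`. -/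
def loebOuter {X : Type*} (I : NS 𝓤 (Set X)) : OuterMeasure (NS 𝓤 X) :=
  OuterMeasure.ofFunction (loebContentSet I) (loebContentSet_empty I)

/-- The Loeb measure of the hyperfinite set `I`, on the `σ`-algebra of Carathéodory measurable
sets. It is regarded as a measure on the whole extension of `X`, concentrated on `I`. -/
def loebMeasure {X : Type*} (I : NS 𝓤 (Set X)) :
    @Measure (NS 𝓤 X) (loebOuter I).caratheodory :=
  @OuterMeasure.toMeasure (NS 𝓤 X) (loebOuter I).caratheodory (loebOuter I) le_rfl

variable {G : Type*} [Group G]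

/-- The internal ball `B(g, N)`. -/
def nsBall (S : Set G) (g : NS 𝓤 G) (N : NS 𝓤 ℕ) : NS 𝓤 (Set G) := Germ.map₂ (ball S) g N

/-- The extension of the word metric, with hyperreal values. -/
def nsDist (S : Set G) (x y : NS 𝓤 G) : NS 𝓤 ℝ := natToReal (Germ.map₂ (wordDist S) x y)

/-- The equivalence class `eq_N(x)`: all `y` for which `d(x, y) / N` is infinitesimal. -/
def eqClass (S : Set G) (N : NS 𝓤 ℕ) (x : NS 𝓤 G) : Set (NS 𝓤 G) :=
  {y | ∀ ε : ℝ, 0 < ε → nsDist S x y / natToReal N < (ε : NS 𝓤 ℝ)}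

/-- `λ_{g,N}`, evaluated on a set `E` of equivalence classes: the pushforward under `eq_N` of the
Loeb measure of `B(g, N)`. -/
def coneMeasure (S : Set G) (g : NS 𝓤 G) (N : NS 𝓤 ℕ) (E : Set (Set (NS 𝓤 G))) : ℝ≥0∞ :=
  loebMeasure (nsBall S g N) (eqClass S N ⁻¹' E ∩ toSet (nsBall S g N))

/-- `λ_I(A)` for the ball `I = B(g, N)` and an internal set `A`. -/
def lam (S : Set G) (A : NS 𝓤 (Set G)) (g : NS 𝓤 G) (N : NS 𝓤 ℕ) : ℝ≥0∞ :=
  coneMeasure S g N (eqClass S N '' (toSet A ∩ toSet (nsBall S g N)))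

/-- `g_A(I)` for the ball `I = B(g, N)` and an internal set `A`. -/
def gap (S : Set G) (A : NS 𝓤 (Set G)) (g : NS 𝓤 G) (N : NS 𝓤 ℕ) : NS 𝓤 ℝ :=
  Germ.map₂ (gapRatio S) A (nsBall S g N)

/-- `A` has the ball measure property on the ball `B(g, N)`. -/
def HasBM (S : Set G) (A : NS 𝓤 (Set G)) (g : NS 𝓤 G) (N : NS 𝓤 ℕ) : Prop :=
  ∀ ε : ℝ, 0 < ε → ∃ δ : ℝ, 0 < δ ∧
    ∀ (h : NS 𝓤 G) (M : NS 𝓤 ℕ), IsInfinite M →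
      toSet (nsBall S h M) ⊆ toSet (nsBall S g N) →
      gap S A h M ≤ (δ : NS 𝓤 ℝ) → ENNReal.ofReal (1 - ε) ≤ lam S A h M

/-- `A` has the enhanced ball measure property on the ball `B(g, N)`. -/
def HasEnhancedBM (S : Set G) (A : NS 𝓤 (Set G)) (g : NS 𝓤 G) (N : NS 𝓤 ℕ) : Prop :=
  HasBM S A g N ∧ 0 < lam S A g N

end Nonstandard

end BallMeasure

end

/-! The core is an induction on `n`, in `exists_hasEnhancedBM`. Suppose that `B 0` lacks the
enhanced BM property on `I`. Then some infinite ball `J ⊆ I` has `λ_J(B 0) < λ_J(A)`. If `B 0` has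
the BM property but `λ_I(B 0) = 0`, take `J = I`. Otherwise the BM property of `B 0` fails for some
`ε`; test it with the `δ` that `A` has for this `ε`. The resulting `J` satisfies `g_A(J) ≤ g_{B
0}(J) ≤ δ`, so `λ_J(A) ≥ 1 - ε > λ_J(B 0)`. By `exists_ball_disjoint_lam_pos`, a smaller infinite
ball misses `B 0` and still gives `A` positive measure. There `A` keeps the BM property and is
covered by the other pieces.

To find this smaller ball in `J = B(g, M)`, consider the points that are near `A` but not near `B
0`; they have positive outer measure. A thin annulus at the boundary of `J` cannot carry all of it.
Every other such point is the centre of a ball of radius `M / (k + j)` that misses `B 0`, for some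
standard `k`, and countable subadditivity fixes one `k`. A finite cover by balls of much smaller
radius then concentrates positive measure around a single point, and the ball about that point is
the one required.

Two geometric facts enter: balls are covered by boundedly many balls of a fixed fraction of the
radius, and thin annuli are relatively small. Both follow from `HasBallCovering`, the second by
comparing neighbouring annuli (`ncard_annulus_mul_le`).

`HasBallCovering` is proved for nilpotent groups by giving an iterated commutator of weight `w` the
cost `n ^ (-w)`. Elements of word length `O(n)` have bounded cost. Conversely, bounded cost gives
word length `O(n)`, since the `n ^ w`-th power of a letter of weight `w` has length `O(n)` up to
terms of higher weight (`letter_pow_eq_mul`). Cost balls have uniform coverings, by collecting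
letters. Schreier generators carry the result over from a subgroup of finite index. -/

noncomputable section

namespace BallMeasure

/-! ### Weighted word lengths -/

section WordCost

open scoped commutatorElement

variable {G : Type*} [Group G] {α : Type*}

/-- `WordCost u w F κ r g`: the element `g` is a product of letters `u a`, `a ∈ F`, and their
inverses, of total cost at most `r`, where the letter `u a` costs `κ ^ w a`. -/
inductive WordCost (u : α → G) (w : α → ℕ) (F : Set α) (κ : ℝ) : ℝ → G → Prop
  | one {r : ℝ} (hr : 0 ≤ r) : WordCost u w F κ r 1
  | mul {r r' : ℝ} {g x : G} {a : α} (ha : a ∈ F) (hx : x = u a ∨ x = (u a)⁻¹)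
      (hg : WordCost u w F κ r g) (hr : r + κ ^ w a ≤ r') : WordCost u w F κ r' (g * x)

/-- The letters of weight at least `k` generate `letterSpan u w k`. -/
def letterSpan (u : α → G) (w : α → ℕ) (k : ℕ) : Subgroup G :=
  Subgroup.closure (u '' {a | k ≤ w a})

namespace WordCost

variable {u : α → G} {w : α → ℕ} {F F' : Set α} {κ r s : ℝ} {g h : G}

theorem mono (hg : WordCost u w F κ r g) (hrs : r ≤ s) (hF : F ⊆ F') :
    WordCost u w F' κ s g := by
  induction hg generalizing s with
  | one hr => exact .one (hr.trans hrs)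
  | mul ha hx _ hr ih => exact .mul (hF ha) hx (ih le_rfl) (hr.trans hrs)

theorem mono_right (hg : WordCost u w F κ r g) (hrs : r ≤ s) : WordCost u w F κ s g :=
  hg.mono hrs subset_rfl

theorem nonneg (hκ : 0 ≤ κ) (hg : WordCost u w F κ r g) : 0 ≤ r := by
  induction hg with
  | one hr => exact hr
  | mul _ _ _ hr ih => exact le_trans (by positivity) hr

theorem letter {a : α} (ha : a ∈ F) : WordCost u w F κ (κ ^ w a) (u a) := by
  simpa using WordCost.mul (x := u a) ha (.inl rfl) (.one le_rfl) (by simp)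

theorem letter_inv {a : α} (ha : a ∈ F) : WordCost u w F κ (κ ^ w a) (u a)⁻¹ := by
  simpa using WordCost.mul (x := (u a)⁻¹) ha (.inr rfl) (.one le_rfl) (by simp)

theorem mul' (hg : WordCost u w F κ r g) (hh : WordCost u w F κ s h) :
    WordCost u w F κ (r + s) (g * h) := by
  induction hh with
  | one hr => simpa using hg.mono_right (by linarith)
  | mul ha hx _ hr ih =>
    rw [← mul_assoc]
    exact .mul ha hx ih (by linarith)

theorem inv (hg : WordCost u w F κ r g) : WordCost u w F κ r g⁻¹ := by
  induction hg with
  | one hr => simpa using WordCost.one hr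
  | @mul r r' g x a ha hx _ hr ih =>
    rw [mul_inv_rev]
    have hx' : WordCost u w F κ (κ ^ w a) x⁻¹ := by
      rcases hx with rfl | rfl
      · exact letter_inv ha
      · simpa using letter ha
    exact (hx'.mul' ih).mono_right (by linarith)

theorem pow (hg : WordCost u w F κ r g) (n : ℕ) :
    WordCost u w F κ (n * r) (g ^ n) := by
  induction n with
  | zero => simpa using WordCost.one le_rfl
  | succ n ih =>
    rw [pow_succ]
    exact (ih.mul' hg).mono_right (by push_cast; linarith)

theorem zpow (hg : WordCost u w F κ r g) (n : ℤ) :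
    WordCost u w F κ (|(n : ℝ)| * r) (g ^ n) := by
  obtain ⟨m, rfl | rfl⟩ := n.eq_nat_or_neg
  · simpa using hg.pow m
  · simpa using (hg.pow m).inv

theorem of_empty (hg : WordCost u w ∅ κ r g) : g = 1 := by
  cases hg with
  | one hr => rfl
  | mul ha => exact absurd ha (Set.notMem_empty _)

/-- One fixed word serves for all `κ`: since `κ ≤ 1`, each of its letters costs at most `κ ^ k`, so
`K` can be its length. -/
theorem of_mem_letterSpan {k : ℕ} (hg : g ∈ letterSpan u w k) :
    ∃ K : ℝ, 0 ≤ K ∧ ∀ κ : ℝ, 0 < κ → κ ≤ 1 → WordCost u w {a | k ≤ w a} κ (K * κ ^ k) g := by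
  induction hg using Subgroup.closure_induction with
  | mem x hx =>
    obtain ⟨a, ha, rfl⟩ := hx
    refine ⟨1, zero_le_one, fun κ h0 h1 => (letter ha).mono_right ?_⟩
    rw [one_mul]
    exact pow_le_pow_of_le_one h0.le h1 ha
  | one => exact ⟨0, le_rfl, fun κ h0 h1 => .one (by simp)⟩
  | mul x y _ _ hx hy =>
    obtain ⟨K, hK, hx⟩ := hx
    obtain ⟨L, hL, hy⟩ := hy
    exact ⟨K + L, by positivity, fun κ h0 h1 =>
      ((hx κ h0 h1).mul' (hy κ h0 h1)).mono_right (by linarith)⟩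
  | inv x _ hx =>
    obtain ⟨K, hK, hx⟩ := hx
    exact ⟨K, hK, fun κ h0 h1 => (hx κ h0 h1).inv⟩

end WordCost

theorem exists_uniform_bound {β : Type*} [Finite β] {P : β → ℝ → Prop}
    (hP : ∀ b K L, K ≤ L → P b K → P b L) (h : ∀ b, ∃ K, P b K) : ∃ K, 0 ≤ K ∧ ∀ b, P b K := by
  choose f hf using h
  obtain ⟨M, hM⟩ := (Set.finite_range f).bddAbove
  exact ⟨max M 0, le_max_right _ _, fun b =>
    hP b _ _ ((hM (Set.mem_range_self b)).trans (le_max_left _ _)) (hf b)⟩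

/-- The commutator of elements of weights `i` and `j` has weight `i + j`. -/
def IsWeightFiltration (u : α → G) (w : α → ℕ) : Prop :=
  (∀ a, 1 ≤ w a) ∧ ∀ i j, ∀ x ∈ letterSpan u w i, ∀ y ∈ letterSpan u w j,
    ⁅x, y⁆ ∈ letterSpan u w (i + j)

variable {u : α → G} {w : α → ℕ}

theorem letter_mem_letterSpan {a : α} {x : G} (hx : x = u a ∨ x = (u a)⁻¹) :
    x ∈ letterSpan u w (w a) := by
  have : u a ∈ letterSpan u w (w a) := Subgroup.subset_closure ⟨a, le_refl (w a), rfl⟩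
  rcases hx with rfl | rfl
  · exact this
  · exact inv_mem this

/-- Only finitely many pairs of signed letters occur, so the constants from `of_mem_letterSpan` have
a common bound. -/
theorem wordCost_commutator_letter_letter [Finite α] (hw : IsWeightFiltration u w) :
    ∃ K : ℝ, 0 ≤ K ∧ ∀ κ : ℝ, 0 < κ → κ ≤ 1 → ∀ a b : α, ∀ x y : G,
      (x = u a ∨ x = (u a)⁻¹) → (y = u b ∨ y = (u b)⁻¹) →
      WordCost u w {c | w a + w b ≤ w c} κ (K * κ ^ (w a + w b)) ⁅x, y⁆ := by
  let sg : Bool → G → G := fun e x => if e then x else x⁻¹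
  have key := exists_uniform_bound (β := α × α × Bool × Bool)
    (P := fun p K => ∀ κ : ℝ, 0 < κ → κ ≤ 1 → WordCost u w {c | w p.1 + w p.2.1 ≤ w c} κ
      (K * κ ^ (w p.1 + w p.2.1)) ⁅sg p.2.2.1 (u p.1), sg p.2.2.2 (u p.2.1)⁆)
    (fun p K L hKL h κ h0 h1 => (h κ h0 h1).mono_right (by gcongr))
    (fun p => by
      obtain ⟨K, -, hK⟩ := WordCost.of_mem_letterSpan (hw.2 (w p.1) (w p.2.1)
        (sg p.2.2.1 (u p.1)) (letter_mem_letterSpan (a := p.1)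
          (by by_cases h : p.2.2.1 <;> simp [sg, h]))
        (sg p.2.2.2 (u p.2.1)) (letter_mem_letterSpan (a := p.2.1)
          (by by_cases h : p.2.2.2 <;> simp [sg, h])))
      exact ⟨K, hK⟩)
  obtain ⟨K, hK0, hK⟩ := key
  refine ⟨K, hK0, fun κ h0 h1 a b x y hx hy => ?_⟩
  rcases hx with rfl | rfl <;> rcases hy with rfl | rfl
  · simpa [sg] using hK (a, b, true, true) κ h0 h1
  · simpa [sg] using hK (a, b, true, false) κ h0 h1
  · simpa [sg] using hK (a, b, false, true) κ h0 h1
  · simpa [sg] using hK (a, b, false, false) κ h0 h1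

/-- Letters change under conjugation by elements of bounded cost by elements of higher weight and
comparable cost. -/
theorem wordCost_commutator_letter [Finite α] (hw : IsWeightFiltration u w) {R : ℝ} (hR : 0 ≤ R) :
    ∃ K : ℝ, 0 ≤ K ∧ ∀ κ : ℝ, 0 < κ → κ ≤ 1 → ∀ a : α, ∀ x : G, (x = u a ∨ x = (u a)⁻¹) →
      ∀ r ≤ R, ∀ g, WordCost u w Set.univ κ r g →
        WordCost u w {c | w a + 1 ≤ w c} κ (K * r * κ ^ w a) ⁅g, x⁆ := by
  obtain ⟨K₀, hK₀, hcomm⟩ := wordCost_commutator_letter_letter hw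
  obtain ⟨m, hm⟩ := (Set.finite_range w).bddAbove
  -- Downward induction on the weight `k`; above the maximal weight `m` there are no letters.
  suffices H : ∀ j k : ℕ, m + 1 ≤ k + j → ∃ K : ℝ, 0 ≤ K ∧ ∀ κ : ℝ, 0 < κ → κ ≤ 1 → ∀ a : α,
      k ≤ w a → ∀ x : G, (x = u a ∨ x = (u a)⁻¹) →
      ∀ r ≤ R, ∀ g, WordCost u w Set.univ κ r g →
        WordCost u w {c | w a + 1 ≤ w c} κ (K * r * κ ^ w a) ⁅g, x⁆ by
    obtain ⟨K, hK, h⟩ := H (m + 1) 0 (by omega)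
    exact ⟨K, hK, fun κ h0 h1 a => h κ h0 h1 a (Nat.zero_le _)⟩
  intro j
  induction j with
  | zero =>
    intro k hk
    refine ⟨0, le_rfl, fun κ h0 h1 a ha => ?_⟩
    have := hm (Set.mem_range_self a)
    omega
  | succ j ih =>
    intro k hk
    obtain ⟨K, hK, ihK⟩ := ih (k + 1) (by omega)
    -- The bound for heavier letters already controls conjugation of heavier words, through `g x g⁻¹
    -- = ⁅g, x⁆ x`.
    have hconj : ∀ κ : ℝ, 0 < κ → κ ≤ 1 → ∀ r ≤ R, ∀ g, WordCost u w Set.univ κ r g →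
        ∀ s h, WordCost u w {c | k + 1 ≤ w c} κ s h →
          WordCost u w {c | k + 1 ≤ w c} κ ((K * R + 1) * s) (g * h * g⁻¹) := by
      intro κ h0 h1 r hr g hg s h hh
      induction hh with
      | one hs => simpa using WordCost.one (by positivity)
      | @mul s s' h x a ha hx _ hs ih2 =>
        have h2 : WordCost u w {c | k + 1 ≤ w c} κ (κ ^ w a) x := by
          rcases hx with rfl | rfl
          · exact .letter ha
          · exact .letter_inv ha
        have h3 := (ihK κ h0 h1 a ha x hx r hr g hg).mono le_rfl
          (F' := {c | k + 1 ≤ w c}) (fun c hc => by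
            simp only [Set.mem_ofPred_eq] at *; omega)
        have h4 := ih2.mul' (h3.mul' h2)
        have h5 : g * (h * x) * g⁻¹ = g * h * g⁻¹ * (⁅g, x⁆ * x) := by
          rw [commutatorElement_def]; group
        rw [h5]
        refine h4.mono_right ?_
        have h6 : 0 < κ ^ w a := by positivity
        have h7 : K * r * κ ^ w a ≤ K * R * κ ^ w a := by gcongr
        have h8 : (K * R + 1) * (s + κ ^ w a) ≤ (K * R + 1) * s' := by gcongr
        nlinarith
    refine ⟨max K ((K * R + 1) * K₀), hK.trans (le_max_left _ _),
      fun κ h0 h1 a ha x hx r hr g hg => ?_⟩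
    rcases Nat.lt_or_ge k (w a) with hka | hka
    · have hr0 := hg.nonneg h0.le
      refine (ihK κ h0 h1 a hka x hx r hr g hg).mono_right ?_
      gcongr
      exact le_max_left _ _
    · obtain rfl : k = w a := le_antisymm ha hka
      -- Induction on the word for `g`: its letter `y` contributes a conjugate of `⁅y, x⁆`, which
      -- consists of heavier letters, so `hconj` applies and the costs add up linearly in `r`.
      have hstep : WordCost u w {c | w a + 1 ≤ w c} κ ((K * R + 1) * K₀ * r * κ ^ w a) ⁅g, x⁆ := by
        induction hg with
        | one hr' => simpa using WordCost.one (by positivity)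
        | @mul r r' g y b hb hy hg hr' ih2 =>
          have hr0 := hg.nonneg h0.le
          have hb0 : 0 < κ ^ w b := by positivity
          have h2 := ih2 (by linarith)
          have h3 := (hcomm κ h0 h1 b a y x hy hx).mono le_rfl (F' := {c | w a + 1 ≤ w c})
            (fun c hc => by
              have := hw.1 b
              simp only [Set.mem_ofPred_eq] at *; omega)
          have h4 := (hconj κ h0 h1 r (by linarith) g hg _ _ h3).mul' h2
          have h5 : ⁅g * y, x⁆ = g * ⁅y, x⁆ * g⁻¹ * ⁅g, x⁆ := by
            simp only [commutatorElement_def]; group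
          rw [h5]
          refine h4.mono_right ?_
          have h6 : (K * R + 1) * K₀ * (r + κ ^ w b) * κ ^ w a ≤
            (K * R + 1) * K₀ * r' * κ ^ w a := by gcongr
          rw [pow_add]
          nlinarith
      have hr0 := hg.nonneg h0.le
      refine hstep.mono_right ?_
      gcongr
      exact le_max_right _ _

/-- Conjugation changes a letter of `F` only by heavier letters. These have weight at least `k + 1`
and so belong to `F`; hence `F` may contain an arbitrary part of the letters of weight `k`. -/
theorem wordCost_conj [Finite α] (hw : IsWeightFiltration u w) {R : ℝ} (hR : 0 ≤ R) :
    ∃ K : ℝ, 1 ≤ K ∧ ∀ κ : ℝ, 0 < κ → κ ≤ 1 → ∀ (k : ℕ) (F : Set α),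
      {c | k + 1 ≤ w c} ⊆ F → F ⊆ {c | k ≤ w c} → ∀ g, WordCost u w Set.univ κ R g →
        ∀ s h, WordCost u w F κ s h → WordCost u w F κ (K * s) (g * h * g⁻¹) := by
  obtain ⟨K, hK, hletter⟩ := wordCost_commutator_letter hw hR
  refine ⟨K * R + 1, by nlinarith [mul_nonneg hK hR],
    fun κ h0 h1 k F hF1 hF2 g hg s h hh => ?_⟩
  induction hh with
  | one hs => simpa using WordCost.one (by positivity)
  | @mul s s' h x a ha hx _ hs ih2 =>
    have h2 : WordCost u w F κ (κ ^ w a) x := by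
      rcases hx with rfl | rfl
      · exact .letter ha
      · exact .letter_inv ha
    have h3 := (hletter κ h0 h1 a x hx R le_rfl g hg).mono le_rfl
      (F' := F) (fun c hc => hF1 (by
        have := hF2 ha
        simp only [Set.mem_ofPred_eq] at *; omega))
    have h4 := ih2.mul' (h3.mul' h2)
    have h5 : g * (h * x) * g⁻¹ = g * h * g⁻¹ * (⁅g, x⁆ * x) := by
      rw [commutatorElement_def]; group
    rw [h5]
    refine h4.mono_right ?_
    have h8 : (K * R + 1) * (s + κ ^ w a) ≤ (K * R + 1) * s' := by gcongr
    nlinarith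

/-- The identity `⁅g, h x⁆ = ⁅g, h⁆ · h ⁅g, x⁆ h⁻¹` adds one letter at a time, and `wordCost_conj`
absorbs the conjugation. -/
theorem wordCost_commutator [Finite α] (hw : IsWeightFiltration u w) {R : ℝ} (hR : 0 ≤ R) :
    ∃ K : ℝ, 0 ≤ K ∧ ∀ κ : ℝ, 0 < κ → κ ≤ 1 → ∀ k : ℕ, ∀ g, WordCost u w Set.univ κ R g →
      ∀ s ≤ R, ∀ h, WordCost u w {c | k ≤ w c} κ s h →
        WordCost u w {c | k + 1 ≤ w c} κ (K * s) ⁅g, h⁆ := by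
  obtain ⟨K, hK, hletter⟩ := wordCost_commutator_letter hw hR
  obtain ⟨L, hL, hconj⟩ := wordCost_conj hw hR
  refine ⟨L * (K * R), by positivity, fun κ h0 h1 k g hg s hs h hh => ?_⟩
  induction hh with
  | one hs => simpa using WordCost.one (by positivity)
  | @mul s s' h x a ha hx hh hs' ih2 =>
    have hs0 : 0 < κ ^ w a := by positivity
    have h2 := ih2 (by linarith)
    have h3 := (hletter κ h0 h1 a x hx R le_rfl g hg).mono le_rfl
      (F' := {c | k + 1 ≤ w c}) (fun c hc => by
        simp only [Set.mem_ofPred_eq] at *; omega)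
    have h4 := hconj κ h0 h1 (k + 1) {c | k + 1 ≤ w c}
      (fun c hc => by simp only [Set.mem_ofPred_eq] at *; omega) subset_rfl h
      (hh.mono (by linarith) (Set.subset_univ _)) _ _ h3
    have h5 : ⁅g, h * x⁆ = ⁅g, h⁆ * (h * ⁅g, x⁆ * h⁻¹) := by
      simp only [commutatorElement_def]; group
    rw [h5]
    refine (h2.mul' h4).mono_right ?_
    have h8 : L * (K * R) * (s + κ ^ w a) ≤ L * (K * R) * s' := by gcongr
    nlinarith

/-- The occurrences of a letter of minimal weight can be collected at the end of a word. -/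
theorem wordCost_collect [Finite α] (hw : IsWeightFiltration u w) {R : ℝ} (hR : 0 ≤ R) :
    ∃ K : ℝ, 0 ≤ K ∧ ∀ κ : ℝ, 0 < κ → κ ≤ 1 → ∀ (k : ℕ) (F : Set α),
      {c | k + 1 ≤ w c} ⊆ F → F ⊆ {c | k ≤ w c} → ∀ v, w v = k →
      ∀ r ≤ R, ∀ g, WordCost u w (insert v F) κ r g →
        ∃ (a : ℤ) (f : G), |(a : ℝ)| * κ ^ k ≤ r ∧ WordCost u w F κ (K * r) f ∧ g = f * u v ^ a := by
  obtain ⟨K, hK, hconj⟩ := wordCost_conj hw hR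
  refine ⟨K, by linarith, fun κ h0 h1 k F hF1 hF2 v hv r hr g hg => ?_⟩
  induction hg with
  | one hr' => exact ⟨0, 1, by simpa using hr', .one (by nlinarith), by simp⟩
  | @mul r r' g x b hb hx hg hr' ih =>
    have hb0 : 0 < κ ^ w b := by positivity
    obtain ⟨a, f, ha, hf, rfl⟩ := ih (by linarith)
    have hr0 : 0 ≤ r := hg.nonneg h0.le
    have hKr : K * r + K * κ ^ w b ≤ K * r' := by nlinarith
    rcases hb with rfl | hb
    · have h2 : ∀ e : ℤ, |(e : ℝ)| ≤ 1 → |((a + e : ℤ) : ℝ)| * κ ^ k ≤ r' := by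
        intro e he
        push_cast
        have := abs_add_le (a : ℝ) e
        rw [hv] at hr' hb0
        nlinarith
      have h3 : WordCost u w F κ (K * r') f := hf.mono_right (by nlinarith)
      rcases hx with rfl | rfl
      · exact ⟨a + 1, f, h2 1 (by simp), h3, by rw [zpow_add_one, mul_assoc]⟩
      · exact ⟨a + -1, f, h2 (-1) (by simp), h3, by rw [zpow_add, zpow_neg_one, mul_assoc]⟩
    · have h2 : WordCost u w F κ (κ ^ w b) x := by
        rcases hx with rfl | rfl
        · exact .letter hb
        · exact .letter_inv hb
      -- The power of `v` collected so far has bounded cost, so moving it past `x` multiplies the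
      -- cost of `x` by at most `K`.
      have h3 : WordCost u w Set.univ κ R (u v ^ a) :=
        ((WordCost.letter (Set.mem_univ v)).zpow a).mono_right (by rw [hv]; linarith)
      have h4 := hconj κ h0 h1 k F hF1 hF2 _ h3 _ _ h2
      refine ⟨a, f * (u v ^ a * x * (u v ^ a)⁻¹), by linarith,
        (hf.mul' h4).mono_right hKr, by group⟩

/-- Induction over the sets of letters that contain, with a letter, all letters of larger weight. -/
theorem letter_induction [Finite α] (w : α → ℕ) {P : Set α → Prop} (h0 : P ∅)
    (hstep : ∀ (k : ℕ) (F : Set α) (v : α), {c | k + 1 ≤ w c} ⊆ F → F ⊆ {c | k ≤ w c} → w v = k →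
      P F → P (insert v F)) : P Set.univ := by
  obtain ⟨m, hm⟩ := (Set.finite_range w).bddAbove
  suffices H : ∀ j k : ℕ, m + 1 ≤ k + j → P {c | k ≤ w c} by
    simpa using H (m + 1) 0 (by omega)
  intro j
  induction j with
  | zero =>
    intro k hk
    convert h0
    ext c
    have := hm (Set.mem_range_self c)
    simp
    omega
  | succ j ih =>
    intro k hk
    have h1 := ih (k + 1) (by omega)
    have h2 : ∀ T : Set α, T ⊆ {c | w c = k} → P (T ∪ {c | k + 1 ≤ w c}) := by
      intro T hT
      induction T, Set.toFinite T using Set.Finite.induction_on with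
      | empty => simpa using h1
      | @insert v T _ _ ih2 =>
        rw [Set.insert_union]
        refine hstep k _ v Set.subset_union_right ?_ (hT (Set.mem_insert _ _))
          (ih2 ((Set.subset_insert _ _).trans hT))
        rintro c (hc | hc)
        · exact (hT (Set.mem_insert_of_mem _ hc)).ge
        · exact (Nat.le_succ k).trans hc
    convert h2 _ subset_rfl using 1
    ext c
    simp
    omega

/-- Cost balls of bounded radius are covered by boundedly many translates of small cost balls. -/
theorem wordCost_covering [Finite α] (hw : IsWeightFiltration u w) {R ε : ℝ} (hR : 0 ≤ R)
    (hε : 0 < ε) : ∃ K : ℕ, ∀ κ : ℝ, 0 < κ → κ ≤ 1 → ∃ Y : Finset G, Y.card ≤ K ∧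
      ∀ g, WordCost u w Set.univ κ R g → ∃ y ∈ Y, WordCost u w Set.univ κ ε (y⁻¹ * g) := by
  classical
  revert R ε
  refine letter_induction (P := fun F => ∀ {R ε : ℝ}, 0 ≤ R → 0 < ε → ∃ K : ℕ, ∀ κ : ℝ, 0 < κ →
    κ ≤ 1 → ∃ Y : Finset G, Y.card ≤ K ∧ ∀ g, WordCost u w F κ R g → ∃ y ∈ Y,
      WordCost u w F κ ε (y⁻¹ * g)) w ?_ ?_
  · intro R ε hR hε
    refine ⟨1, fun κ h0 h1 => ⟨{1}, by simp, fun g hg => ⟨1, by simp, ?_⟩⟩⟩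
    rw [hg.of_empty]
    simpa using WordCost.one hε.le
  · intro k F v hF1 hF2 hv ih R ε hR hε
    obtain ⟨K₁, hK₁, hcoll⟩ := wordCost_collect hw hR
    obtain ⟨K₂, hK₂, hconj⟩ := wordCost_conj hw (R := R + ε + 1) (by positivity)
    obtain ⟨K₃, hcov⟩ := ih (R := K₂ * (K₁ * R)) (ε := ε / 2) (by positivity) (by positivity)
    obtain ⟨E, hE⟩ := exists_nat_ge (2 * R / ε + 1)
    refine ⟨(2 * E + 1) * K₃, fun κ h0 h1 => ?_⟩
    obtain ⟨Y, hY, hYcov⟩ := hcov κ h0 h1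
    have hκ : 0 < κ ^ k := by positivity
    have hκ1 : κ ^ k ≤ 1 := pow_le_one₀ h0.le h1
    -- The least `m` for which the bound `m * κ ^ k` on the cost of `u v ^ m` reaches `ε / 2`.
    -- Remainders modulo `m` then cost at most `ε / 2`, while the quotients `e` are bounded by `2 *
    -- R / ε + 1`, independently of `κ`.
    set m : ℕ := ⌈ε / 2 / κ ^ k⌉₊ with hm
    have hm1 : ε / 2 ≤ m * κ ^ k := by
      rw [← div_le_iff₀ hκ]; exact Nat.le_ceil _
    have hm2 : (m : ℝ) * κ ^ k < ε / 2 + κ ^ k := by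
      have := Nat.ceil_lt_add_one (a := ε / 2 / κ ^ k) (by positivity)
      rw [← hm] at this
      calc (m : ℝ) * κ ^ k < (ε / 2 / κ ^ k + 1) * κ ^ k := by gcongr
        _ = _ := by field_simp
    have hm0 : 0 < m := Nat.ceil_pos.2 (by positivity)
    refine ⟨(Finset.Icc (-E : ℤ) E ×ˢ Y).image (fun p => u v ^ (p.1 * (m : ℤ)) * p.2), ?_, ?_⟩
    · refine Finset.card_image_le.trans ?_
      rw [Finset.card_product, Int.card_Icc]
      gcongr
      omega
    · intro g hg
      obtain ⟨a, f, ha, hf, rfl⟩ := hcoll κ h0 h1 k F hF1 hF2 v hv R le_rfl g hg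
      set e := a / (m : ℤ) with he
      set b := a % (m : ℤ) with hb
      have hab : b + e * m = a := by rw [he, hb, mul_comm]; exact Int.emod_add_mul_ediv a m
      have hb0 : 0 ≤ b := Int.emod_nonneg _ (by omega)
      have hbm : b < m := Int.emod_lt_of_pos _ (by omega)
      have habR : (b : ℝ) + e * m = a := by exact_mod_cast hab
      have hb0R : (0 : ℝ) ≤ b := by exact_mod_cast hb0
      have hbmR : (b : ℝ) + 1 ≤ m := by exact_mod_cast hbm
      have hem : |(e : ℝ) * m| * κ ^ k ≤ R + m * κ ^ k := by
        have h2 : (e : ℝ) * m = a - b := by linarith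
        rw [h2]
        have h3 := abs_sub (a : ℝ) b
        rw [abs_of_nonneg hb0R] at h3
        nlinarith
      have hemR : |(e : ℝ)| ≤ E := by
        refine le_trans ?_ hE
        rw [abs_mul, abs_of_nonneg (Nat.cast_nonneg m : (0 : ℝ) ≤ m)] at hem
        have h3 : (|(e : ℝ)| - 1) * (m * κ ^ k) ≤ R := by linarith
        rcases le_or_gt (|(e : ℝ)|) 1 with h4 | h4
        · have : 0 ≤ 2 * R / ε := by positivity
          linarith
        · have h5 : (|(e : ℝ)| - 1) * (ε / 2) ≤ R := le_trans (by gcongr) h3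
          have h6 : |(e : ℝ)| - 1 ≤ 2 * R / ε := by
            rw [le_div_iff₀ hε]; linarith
          linarith
      have hvc : WordCost u w Set.univ κ (R + ε + 1) (u v ^ (-(e * (m : ℤ)))) := by
        refine ((WordCost.letter (Set.mem_univ v)).zpow _).mono_right ?_
        rw [hv]
        push_cast
        rw [abs_neg]
        linarith
      have hf2 := hconj κ h0 h1 k F hF1 hF2 _ hvc _ _ hf
      obtain ⟨y, hy, hyf⟩ := hYcov _ hf2
      refine ⟨u v ^ (e * (m : ℤ)) * y, Finset.mem_image.2 ⟨(e, y), ?_, rfl⟩, ?_⟩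
      · rw [Finset.mem_product, Finset.mem_Icc]
        refine ⟨abs_le.1 ?_, hy⟩
        exact_mod_cast hemR
      · have hvb : WordCost u w (insert v F) κ (ε / 2) (u v ^ b) := by
          refine ((WordCost.letter (Set.mem_insert v F)).zpow _).mono_right ?_
          rw [hv, abs_of_nonneg hb0R]
          nlinarith
        have h7 : (u v ^ (e * (m : ℤ)) * y)⁻¹ * (f * u v ^ a) =
            y⁻¹ * (u v ^ (-(e * (m : ℤ))) * f * (u v ^ (-(e * (m : ℤ))))⁻¹) * u v ^ b := by
          have : u v ^ a = u v ^ (e * (m : ℤ)) * u v ^ b := by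
            rw [← zpow_add, ← hab, add_comm]
          rw [this]
          group
        rw [h7]
        exact ((hyf.mono le_rfl (Set.subset_insert _ _)).mul' hvb).mono_right (by linarith)

end WordCost

/-! ### Powers of a symmetric generating set -/

section Powers

open scoped Pointwise

variable {G : Type*} [Group G] {S : Set G}

namespace IsSymmGenSet

theorem pow_mono (hS : IsSymmGenSet S) {m n : ℕ} (h : m ≤ n) : S ^ m ⊆ S ^ n :=
  Set.pow_subset_pow_right hS.one_mem h

theorem one_mem_pow (hS : IsSymmGenSet S) (n : ℕ) : (1 : G) ∈ S ^ n :=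
  hS.pow_mono (Nat.zero_le n) (by simp)

theorem inv_eq (hS : IsSymmGenSet S) : S⁻¹ = S := by
  ext x
  exact ⟨fun h => by simpa using hS.inv_mem _ h, fun h => hS.inv_mem _ h⟩

theorem inv_mem_pow (hS : IsSymmGenSet S) {n : ℕ} {x : G} (hx : x ∈ S ^ n) : x⁻¹ ∈ S ^ n := by
  rw [← Set.mem_inv, ← inv_pow, hS.inv_eq]
  exact hx

theorem exists_mem_pow (hS : IsSymmGenSet S) (x : G) : ∃ n : ℕ, x ∈ S ^ n := by
  have hx : x ∈ Subgroup.closure S := by rw [hS.closure_eq_top]; trivial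
  induction hx using Subgroup.closure_induction with
  | mem x hx => exact ⟨1, by simpa using hx⟩
  | one => exact ⟨0, by simp⟩
  | mul x y _ _ hx hy =>
    obtain ⟨m, hm⟩ := hx
    obtain ⟨n, hn⟩ := hy
    exact ⟨m + n, by rw [pow_add]; exact Set.mul_mem_mul hm hn⟩
  | inv x _ hx =>
    obtain ⟨n, hn⟩ := hx
    exact ⟨n, hS.inv_mem_pow hn⟩

theorem mul_mem_pow (hS : IsSymmGenSet S) {m n k : ℕ} {x y : G} (hx : x ∈ S ^ m) (hy : y ∈ S ^ n)
    (h : m + n ≤ k) : x * y ∈ S ^ k :=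
  hS.pow_mono h (by rw [pow_add]; exact Set.mul_mem_mul hx hy)

theorem pow_mem_pow (hS : IsSymmGenSet S) {m k n : ℕ} {x : G} (hx : x ∈ S ^ m) (h : m * k ≤ n) :
    x ^ k ∈ S ^ n :=
  hS.pow_mono h (by rw [pow_mul]; exact Set.pow_mem_pow hx)

theorem exists_forall_mem_pow (hS : IsSymmGenSet S) {β : Type*} [Finite β] (f : β → G) :
    ∃ n : ℕ, ∀ b, f b ∈ S ^ n := by
  choose l hl using fun b => hS.exists_mem_pow (f b)
  obtain ⟨M, hM⟩ := (Set.finite_range l).bddAbove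
  exact ⟨M, fun b => hS.pow_mono (hM (Set.mem_range_self b)) (hl b)⟩

theorem finite_pow (hS : IsSymmGenSet S) (n : ℕ) : (S ^ n).Finite := by
  induction n with
  | zero => simp
  | succ n ih => rw [pow_succ]; exact ih.mul hS.finite

end IsSymmGenSet

/-- The balls `S ^ (2 * n)` are covered by boundedly many translates of the balls `S ^ n`. -/
def HasBallCovering (S : Set G) : Prop :=
  ∃ K : ℕ, ∀ n : ℕ, 1 ≤ n → ∃ Y : Finset G, Y.card ≤ K ∧
    ∀ g ∈ S ^ (2 * n), ∃ y ∈ Y, y⁻¹ * g ∈ S ^ n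

end Powers

/-! ### Comparison of cost balls with balls for the word metric -/

section Reach

open scoped commutatorElement Pointwise

variable {G : Type*} [Group G] {α : Type*} {u : α → G} {w : α → ℕ} {S : Set G}

/-- Moving the last `v` to the left past `y ^ q` creates `⁅y ^ q, v⁆`, which is conjugated by `v ^
q` to join the error term. Each of the `q` moves costs at most `K * ρ`. -/
theorem wordCost_mul_pow [Finite α] (hw : IsWeightFiltration u w) {R : ℝ} (hR : 0 ≤ R) :
    ∃ K : ℝ, 0 ≤ K ∧ ∀ κ : ℝ, 0 < κ → κ ≤ 1 → ∀ (k q : ℕ) (ρ : ℝ) (v y : G),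
      (∀ i ≤ q, WordCost u w Set.univ κ R (v ^ i)) →
      (∀ i ≤ q, WordCost u w {c | k ≤ w c} κ ρ ⁅y ^ i, v⁆) →
      ∃ f, WordCost u w {c | k ≤ w c} κ (q * (K * ρ)) f ∧ (v * y) ^ q = f * v ^ q * y ^ q := by
  obtain ⟨K, hK, hconj⟩ := wordCost_conj hw hR
  refine ⟨K, by linarith, fun κ h0 h1 k q ρ v y hv hy => ?_⟩
  induction q with
  | zero => exact ⟨1, .one (by simp), by simp⟩
  | succ q ih =>
    obtain ⟨f, hf, hfq⟩ := ih (fun i hi => hv i (by omega)) (fun i hi => hy i (by omega))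
    have h2 := hconj κ h0 h1 k {c | k ≤ w c} (fun c hc => (Nat.le_succ k).trans hc) subset_rfl
      _ (hv q (by omega)) _ _ (hy q (by omega))
    refine ⟨_, (hf.mul' h2).mono_right (by push_cast; linarith), ?_⟩
    rw [pow_succ, hfq, pow_succ v, pow_succ y, commutatorElement_def]
    group

/-- The letters `u` with weights `w` are iterated commutators of elements of `S`. -/
structure IsLetterSystem (S : Set G) (u : α → G) (w : α → ℕ) : Prop where
  weightFiltration : IsWeightFiltration u w
  exists_letter : ∀ s ∈ S, ∃ a, w a = 1 ∧ u a = s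
  mem_of_weight : ∀ a, w a = 1 → u a ∈ S
  eq_commutator : ∀ a, 2 ≤ w a → ∃ s ∈ S, ∃ b, w a = w b + 1 ∧ u a = ⁅s, u b⁆

namespace IsLetterSystem

theorem wordCost_of_mem_pow (hu : IsLetterSystem S u w) {κ : ℝ} {n : ℕ} {g : G}
    (hg : g ∈ S ^ n) : WordCost u w Set.univ κ (n * κ) g := by
  induction n generalizing g with
  | zero =>
    rw [pow_zero, Set.mem_one] at hg
    rw [hg]
    exact .one (by simp)
  | succ n ih =>
    rw [pow_succ] at hg
    obtain ⟨x, hx, s, hs, rfl⟩ := hg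
    obtain ⟨a, ha, rfl⟩ := hu.exists_letter s hs
    refine ((ih hx).mul' (.letter (Set.mem_univ a))).mono_right ?_
    rw [ha]
    push_cast
    linarith

/-- Commutators are bilinear up to higher weight. The scale `κ = 1 / n` keeps the errors bounded,
because `n * κ = 1` and `q * κ ^ k ≤ 1`. -/
theorem commutator_pow_pow [Finite α] (hu : IsLetterSystem S u w) (k : ℕ) :
    ∃ D : ℝ, 0 ≤ D ∧ ∀ n : ℕ, 1 ≤ n → ∀ s ∈ S, ∀ a b, w b = k → w a = k + 1 →
      u a = ⁅s, u b⁆ → ∀ q ≤ n ^ k, ∃ f f',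
        WordCost u w {c | k + 2 ≤ w c} (n : ℝ)⁻¹ D f ∧
        WordCost u w {c | k + 2 ≤ w c} (n : ℝ)⁻¹ D f' ∧
        ⁅s ^ n, u b ^ q⁆ = f * u a ^ (n * q) * f' := by
  have hw := hu.weightFiltration
  obtain ⟨C₁, hC₁, hcomm₁⟩ := wordCost_commutator hw (R := 1) zero_le_one
  obtain ⟨P₁, hP₁, hpow₁⟩ := wordCost_mul_pow hw (R := 1) zero_le_one
  set D₁ := P₁ * C₁ with hD₁
  have hD₁0 : 0 ≤ D₁ := by positivity
  obtain ⟨C₂, hC₂, hcomm₂⟩ := wordCost_commutator hw (R := 1 + D₁) (by positivity)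
  obtain ⟨P₂, hP₂, hpow₂⟩ := wordCost_mul_pow hw (R := 1 + D₁) (by positivity)
  refine ⟨P₂ * (C₂ * (1 + D₁)) + P₂ * C₂ + D₁, by positivity, ?_⟩
  intro n hn s hs a b hb ha hab q hq
  set κ : ℝ := (n : ℝ)⁻¹ with hκ
  have hn' : (1 : ℝ) ≤ n := by exact_mod_cast hn
  have h0 : 0 < κ := by positivity
  have h1 : κ ≤ 1 := inv_le_one_of_one_le₀ hn'
  have hnκ : (n : ℝ) * κ = 1 := mul_inv_cancel₀ (by positivity)
  have hκk : 0 < κ ^ k := by positivity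
  have hκk1 : κ ^ k ≤ 1 := pow_le_one₀ h0.le h1
  have hqκ : ∀ i ≤ q, (i : ℝ) * κ ^ k ≤ 1 := by
    intro i hi
    have : (i : ℝ) ≤ n ^ k := by exact_mod_cast hi.trans hq
    calc (i : ℝ) * κ ^ k ≤ n ^ k * κ ^ k := by gcongr
      _ = 1 := by rw [← mul_pow, hnκ, one_pow]
  have hnκ1 : (n : ℝ) * κ ^ (k + 1) = κ ^ k := by
    rw [pow_succ]
    linear_combination κ ^ k * hnκ
  have hiκ : ∀ i ≤ n, (i : ℝ) * κ ^ (k + 1) ≤ κ ^ k := by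
    intro i hi
    rw [← hnκ1]
    gcongr
  have hua : WordCost u w {c | k + 1 ≤ w c} κ (κ ^ (k + 1)) (u a) := by
    rw [← ha]; exact .letter (by simp)
  have hub : WordCost u w Set.univ κ (κ ^ k) (u b) := by
    rw [← hb]; exact .letter (Set.mem_univ _)
  have hsi : ∀ i ≤ n, WordCost u w Set.univ κ 1 (s ^ i) := by
    intro i hi
    refine (hu.wordCost_of_mem_pow (Set.pow_mem_pow hs)).mono_right ?_
    rw [← hnκ]
    gcongr
  obtain ⟨f₁, hf₁, hf₁n⟩ := hpow₁ κ h0 h1 (k + 2) n (C₁ * κ ^ (k + 1)) (u a)⁻¹ s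
    -- From `u b * s * (u b)⁻¹ = (u a)⁻¹ * s`, the `n`-th power gives `s ^ n * u b * (s ^ n)⁻¹ = u a
    -- ^ n * f₁⁻¹ * u b`. Its `q`-th power is expanded by two more uses of `wordCost_mul_pow`, with
    -- errors `f₂` and `f₃`.
    (fun i hi => ((hua.inv.pow i).mono (s := 1)
      ((hiκ i hi).trans hκk1) (Set.subset_univ _)))
    (fun i hi => hcomm₁ κ h0 h1 (k + 1) (s ^ i) (hsi i hi) _ (pow_le_one₀ h0.le h1) _ hua.inv)
  have hf₁' : WordCost u w {c | k + 2 ≤ w c} κ (D₁ * κ ^ k) f₁⁻¹ :=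
    hf₁.inv.mono_right (by rw [hD₁, ← hnκ1]; linarith)
  set v := u a ^ n * f₁⁻¹ with hv
  have hsub : {c : α | k + 2 ≤ w c} ⊆ {c | k + 1 ≤ w c} := fun c hc => (Nat.le_succ _).trans hc
  have huan : WordCost u w {c | k + 1 ≤ w c} κ (κ ^ k) (u a ^ n) := by
    rw [← hnκ1]; exact hua.pow n
  have hvc : WordCost u w {c | k + 1 ≤ w c} κ ((1 + D₁) * κ ^ k) v :=
    (huan.mul' (hf₁'.mono le_rfl hsub)).mono_right (by linarith)
  have hconj : s ^ n * u b * (s ^ n)⁻¹ = v * u b := by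
    have h2 : u b * s * (u b)⁻¹ = (u a)⁻¹ * s := by
      rw [hab, commutatorElement_def]; group
    have h3 : u b * s ^ n * (u b)⁻¹ = f₁ * (u a)⁻¹ ^ n * s ^ n := by
      rw [← hf₁n, ← h2, conj_pow]
    have h4 : s ^ n * u b * (s ^ n)⁻¹ = s ^ n * (u b * s ^ n * (u b)⁻¹)⁻¹ * u b := by group
    rw [h4, h3, hv]
    group
  have hle : (1 + D₁) * κ ^ k ≤ 1 + D₁ := mul_le_of_le_one_right (by positivity) hκk1
  obtain ⟨f₂, hf₂, hf₂q⟩ := hpow₂ κ h0 h1 (k + 2) q (C₂ * ((1 + D₁) * κ ^ k)) v (u b)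
    (fun i hi => (hvc.pow i).mono (by nlinarith [hqκ i hi]) (Set.subset_univ _))
    (fun i hi => hcomm₂ κ h0 h1 (k + 1) _
      ((hub.pow i).mono_right ((hqκ i hi).trans (by linarith))) _ hle _ hvc)
  obtain ⟨f₃, hf₃, hf₃q⟩ := hpow₂ κ h0 h1 (k + 2) q (C₂ * κ ^ k) (u a ^ n) f₁⁻¹
    (fun i hi => (huan.pow i).mono ((hqκ i hi).trans (by linarith)) (Set.subset_univ _))
    (fun i hi => hcomm₂ κ h0 h1 (k + 1) _
      ((hf₁'.pow i).mono (by nlinarith [hqκ i hi]) (Set.subset_univ _)) _ (by linarith) _ huan)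
  have hq' := hqκ q le_rfl
  have hPC : 0 ≤ P₂ * C₂ := by positivity
  have hPC' : 0 ≤ P₂ * (C₂ * (1 + D₁)) := by positivity
  refine ⟨f₂ * f₃, f₁⁻¹ ^ q, (hf₂.mul' hf₃).mono_right ?_, (hf₁'.pow q).mono_right ?_, ?_⟩
  · nlinarith
  · nlinarith
  · have h5 : ⁅s ^ n, u b ^ q⁆ = (s ^ n * u b * (s ^ n)⁻¹) ^ q * (u b ^ q)⁻¹ := by
      rw [conj_pow, commutatorElement_def]
    rw [h5, hconj, hf₂q, hv, hf₃q, pow_mul]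
    group

/-- A power `u a ^ q` with `q ≤ n ^ w a` is the product of an element of larger weight of bounded
cost and an element of word length `O(n)`. -/
theorem letter_pow_eq_mul [Finite α] (hS : IsSymmGenSet S) (hu : IsLetterSystem S u w) {k : ℕ}
    (hk : 1 ≤ k) : ∃ K : ℕ, ∀ n : ℕ, 1 ≤ n → ∀ a, w a = k → ∀ q ≤ n ^ k, ∃ e b,
      WordCost u w {c | k + 1 ≤ w c} (n : ℝ)⁻¹ K e ∧ b ∈ S ^ (K * n) ∧ u a ^ q = e * b := by
  have hw := hu.weightFiltration
  induction k, hk using Nat.le_induction with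
  | base =>
    refine ⟨1, fun n hn a ha q hq => ⟨1, u a ^ q, .one (by simp), ?_, by simp⟩⟩
    rw [pow_one] at hq
    exact hS.pow_mem_pow (m := 1) (by simpa using hu.mem_of_weight a ha) (by omega)
  | succ k hk ih =>
    obtain ⟨K, hK⟩ := ih
    obtain ⟨D, hD, hcpp⟩ := hu.commutator_pow_pow k
    obtain ⟨L, hL⟩ := hS.exists_forall_mem_pow u
    obtain ⟨C, hC, hcomm⟩ := wordCost_commutator hw (R := 2 * K + 2) (by positivity)
    obtain ⟨M, hM, hconj⟩ := wordCost_conj hw (R := 2 * K + 2) (by positivity)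
    obtain ⟨T, hT⟩ := exists_nat_ge (D + C * K + C * K + M * D)
    refine ⟨max T (2 * K + 2 + L), fun n hn a ha q hq => ?_⟩
    obtain ⟨s, hs, b, hab, hasb⟩ := hu.eq_commutator a (by omega)
    have hb : w b = k := by omega
    have hqn : q / n ≤ n ^ k := by
      refine Nat.div_le_of_le_mul ?_
      rwa [← pow_succ']
    obtain ⟨f, f', hf, hf', hff'⟩ := hcpp n hn s hs a b hb ha hasb (q / n) hqn
    obtain ⟨e, β, he, hβ, heβ⟩ := hK n hn b hb (q / n) hqn
    set κ : ℝ := (n : ℝ)⁻¹ with hκ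
    have hn' : (1 : ℝ) ≤ n := by exact_mod_cast hn
    have h0 : 0 < κ := by positivity
    have h1 : κ ≤ 1 := inv_le_one_of_one_le₀ hn'
    have hnκ : (n : ℝ) * κ = 1 := mul_inv_cancel₀ (by positivity)
    have hsn : s ^ n ∈ S ^ n := Set.pow_mem_pow hs
    -- With `u b ^ (q / n) = e * β`, the commutator `⁅s ^ n, e * β⁆` equals the short word `γ` up to
    -- commutators with `e`. These have weight at least `k + 2` because `e` has weight at least `k +
    -- 1`.
    set γ := ⁅s ^ n, β⁆ with hγ
    have hγS : γ ∈ S ^ ((2 * K + 2) * n) := by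
      rw [hγ, commutatorElement_def]
      have h2 := hS.mul_mem_pow hsn hβ le_rfl
      have h3 := hS.mul_mem_pow h2 (hS.inv_mem_pow hsn) le_rfl
      exact hS.mul_mem_pow h3 (hS.inv_mem_pow hβ) (by ring_nf; rfl)
    have hγc : WordCost u w Set.univ κ (2 * K + 2) γ := by
      refine (hu.wordCost_of_mem_pow hγS).mono_right ?_
      push_cast
      rw [mul_assoc, hnκ, mul_one]
    have hK2 : (K : ℝ) ≤ 2 * K + 2 := by linarith [(Nat.cast_nonneg K : (0 : ℝ) ≤ K)]
    have hsc : WordCost u w Set.univ κ (2 * K + 2) (s ^ n) :=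
      (hu.wordCost_of_mem_pow hsn).mono_right (by rw [hnκ]; linarith [(Nat.cast_nonneg K : (0 : ℝ) ≤ K)])
    have h2 := hcomm κ h0 h1 (k + 1) _ hsc K hK2 _ he
    have h3 := hcomm κ h0 h1 (k + 1) _ hγc K hK2 _ he
    have h4 := hconj κ h0 h1 (k + 2) {c | k + 2 ≤ w c} (fun c hc => (Nat.le_succ _).trans hc)
      subset_rfl _ hγc _ _ hf'.inv
    refine ⟨f⁻¹ * ⁅s ^ n, e⁆ * ⁅γ, e⁆⁻¹ * (γ * f'⁻¹ * γ⁻¹), γ * u a ^ (q % n),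
      (((hf.inv.mul' h2).mul' h3.inv).mul' h4).mono_right ?_, ?_, ?_⟩
    · push_cast
      exact le_max_of_le_left hT
    · have h5 : u a ^ (q % n) ∈ S ^ (L * n) :=
        hS.pow_mem_pow (hL a) (Nat.mul_le_mul_left _ (Nat.mod_lt _ (by omega)).le)
      exact hS.mul_mem_pow hγS h5 (by rw [← add_mul]; gcongr; exact le_max_right _ _)
    · have h6 : u a ^ q = u a ^ (n * (q / n)) * u a ^ (q % n) := by
        rw [← pow_add, Nat.div_add_mod]
      have h7 : u a ^ (n * (q / n)) = f⁻¹ * ⁅s ^ n, e * β⁆ * f'⁻¹ := by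
        rw [← heβ, hff']; group
      have h8 : ⁅s ^ n, e * β⁆ = ⁅s ^ n, e⁆ * ⁅γ, e⁆⁻¹ * γ := by
        rw [hγ]; simp only [commutatorElement_def]; group
      rw [h6, h7, h8]
      group

/-- Letters are added in order of decreasing weight. Collecting the new letter `v` leaves a word in
the old letters times `u v ^ a` with `|a| ≤ R * n ^ k`, which splits into boundedly many blocks of
exponent at most `n ^ k`. -/
theorem mem_pow_of_wordCost [Finite α] (hS : IsSymmGenSet S) (hu : IsLetterSystem S u w) {R : ℝ}
    (hR : 0 ≤ R) : ∃ K : ℕ, ∀ n : ℕ, 1 ≤ n → ∀ g,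
      WordCost u w Set.univ (n : ℝ)⁻¹ R g → g ∈ S ^ (K * n) := by
  have hw := hu.weightFiltration
  revert R
  refine letter_induction (P := fun F => ∀ {R : ℝ}, 0 ≤ R → ∃ K : ℕ, ∀ n : ℕ, 1 ≤ n → ∀ g,
    WordCost u w F (n : ℝ)⁻¹ R g → g ∈ S ^ (K * n)) w ?_ ?_
  · intro R hR
    refine ⟨0, fun n hn g hg => ?_⟩
    rw [hg.of_empty]
    exact hS.one_mem_pow _
  · intro k F v hF1 hF2 hv ih R hR
    obtain ⟨K₁, hK₁, hcoll⟩ := wordCost_collect hw hR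
    obtain ⟨K₂, hpow⟩ := hu.letter_pow_eq_mul hS (hv ▸ hw.1 v)
    obtain ⟨K₃, hK₃⟩ := ih (R := K₂) (by positivity)
    obtain ⟨K₄, hK₄⟩ := ih (R := K₁ * R) (by positivity)
    obtain ⟨C, hC⟩ := exists_nat_ge R
    refine ⟨K₄ + (K₃ + K₂) * (C + 1), fun n hn g hg => ?_⟩
    have hn' : (1 : ℝ) ≤ n := by exact_mod_cast hn
    obtain ⟨a, f, ha, hf, rfl⟩ := hcoll (n : ℝ)⁻¹ (by positivity) (inv_le_one_of_one_le₀ hn') k F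
      hF1 hF2 v hv R le_rfl g hg
    -- The error `e` uses only letters heavier than `v`; all of them lie in `F`, so the induction
    -- hypothesis covers it.
    have hsmall : ∀ q ≤ n ^ k, u v ^ q ∈ S ^ ((K₃ + K₂) * n) := by
      intro q hq
      obtain ⟨e, b, he, hb, heb⟩ := hpow n hn v hv q hq
      rw [heb]
      exact hS.mul_mem_pow (hK₃ n hn e (he.mono le_rfl hF1)) hb (by rw [add_mul])
    have hbig : ∀ p : ℕ, (p : ℝ) ≤ R * n ^ k → u v ^ p ∈ S ^ ((K₃ + K₂) * (C + 1) * n) := by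
      intro p hp
      have h2 : p ≤ n ^ k * C := by
        have : (p : ℝ) ≤ n ^ k * C := hp.trans (by rw [mul_comm]; gcongr)
        exact_mod_cast this
      have h3 : u v ^ p = (u v ^ (n ^ k)) ^ (p / n ^ k) * u v ^ (p % n ^ k) := by
        rw [← pow_mul, ← pow_add, Nat.div_add_mod]
      rw [h3]
      have h4 := hS.pow_mem_pow (hsmall _ le_rfl) (k := p / n ^ k) (n := (K₃ + K₂) * n * C)
        (Nat.mul_le_mul_left _ (Nat.div_le_of_le_mul h2))
      exact hS.mul_mem_pow h4 (hsmall _ (Nat.mod_lt _ (by positivity)).le)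
        (by ring_nf; rfl)
    have hcast : (a.natAbs : ℝ) ≤ R * n ^ k := by
      rw [inv_pow, ← div_eq_mul_inv, div_le_iff₀ (by positivity)] at ha
      rw [Nat.cast_natAbs, Int.cast_abs]
      exact ha
    have hva : u v ^ a ∈ S ^ ((K₃ + K₂) * (C + 1) * n) := by
      rcases Int.natAbs_eq a with h | h
      · rw [h, zpow_natCast]
        exact hbig _ hcast
      · rw [h, zpow_neg, zpow_natCast]
        exact hS.inv_mem_pow (hbig _ hcast)
    exact hS.mul_mem_pow (hK₄ n hn f hf) hva (by rw [← add_mul])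

theorem hasBallCovering [Finite α] (hS : IsSymmGenSet S) (hu : IsLetterSystem S u w) :
    HasBallCovering S := by
  obtain ⟨K, hK⟩ := hu.mem_pow_of_wordCost hS (R := 1) zero_le_one
  obtain ⟨L, hL⟩ := wordCost_covering hu.weightFiltration (R := 4 * (K + 1)) (ε := 1)
    (by positivity) one_pos
  refine ⟨max L (S ^ (2 * (K + 1))).ncard, fun n hn => ?_⟩
  -- For the finitely many small `n`, a fixed finite ball serves as its own set of centres.
  rcases Nat.lt_or_ge n (K + 1) with hnK | hnK
  · refine ⟨(hS.finite_pow (2 * (K + 1))).toFinset, ?_, fun g hg => ⟨g, ?_, ?_⟩⟩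
    · rw [← Set.ncard_eq_toFinset_card _ (hS.finite_pow (2 * (K + 1)))]
      exact le_max_right _ _
    · rw [Set.Finite.mem_toFinset]
      exact hS.pow_mono (by omega) hg
    · rw [inv_mul_cancel]
      exact hS.one_mem_pow _
  -- At scale `m` the cost ball of radius `1` lies in `S ^ (K * m) ⊆ S ^ n`, while `S ^ (2 * n)` has
  -- cost at most `2 * n / m ≤ 4 * (K + 1)`.
  · set m := n / (K + 1) with hm
    have hm1 : 1 ≤ m := (Nat.one_le_div_iff (by omega)).2 hnK
    have hm' : (1 : ℝ) ≤ m := by exact_mod_cast hm1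
    have hnm : n ≤ 2 * (K + 1) * m := by
      have h2 := Nat.div_add_mod n (K + 1)
      have h3 := Nat.mod_lt n (Nat.succ_pos K)
      rw [← hm] at h2
      nlinarith
    obtain ⟨Y, hY, hYc⟩ := hL (m : ℝ)⁻¹ (by positivity) (inv_le_one_of_one_le₀ hm')
    refine ⟨Y, hY.trans (le_max_left _ _), fun g hg => ?_⟩
    obtain ⟨y, hy, hyg⟩ := hYc g ((hu.wordCost_of_mem_pow hg).mono_right (by
      rw [← div_eq_mul_inv, div_le_iff₀ (by positivity)]
      have : (n : ℝ) ≤ 2 * (K + 1) * m := by exact_mod_cast hnm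
      push_cast
      linarith))
    refine ⟨y, hy, hS.pow_mono ?_ (hK m hm1 _ hyg)⟩
    have := Nat.mul_div_le n (K + 1)
    rw [← hm] at this
    nlinarith

end IsLetterSystem

end Reach

/-! ### Ball coverings in virtually nilpotent groups -/

section Nilpotent

open scoped commutatorElement Pointwise

variable {G : Type*} [Group G] {S : Set G}

/-- The three subgroups lemma, applied in the quotient by `N`. -/
theorem commutator_commutator_le_of_rotate {A B C N : Subgroup G} [N.Normal]
    (h1 : ⁅⁅B, C⁆, A⁆ ≤ N) (h2 : ⁅⁅C, A⁆, B⁆ ≤ N) : ⁅⁅A, B⁆, C⁆ ≤ N := by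
  have key : ∀ P : Subgroup G, P ≤ N ↔ P.map (QuotientGroup.mk' N) = ⊥ := fun P => by
    rw [Subgroup.map_eq_bot_iff, QuotientGroup.ker_mk']
  rw [key, Subgroup.map_commutator, Subgroup.map_commutator] at *
  exact Subgroup.commutator_commutator_eq_bot_of_rotate h1 h2

variable {α : Type*} {u : α → G} {w : α → ℕ}

theorem letterSpan_antitone : Antitone (letterSpan u w) := fun _ _ h =>
  Subgroup.closure_mono (Set.image_mono fun _ ha => h.trans ha)

theorem letter_mem (a : α) : u a ∈ letterSpan u w (w a) :=
  letter_mem_letterSpan (.inl rfl)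

theorem letterSpan_normal (hS : IsSymmGenSet S)
    (hstep : ∀ s ∈ S, ∀ a, ⁅s, u a⁆ ∈ letterSpan u w (w a + 1)) (k : ℕ) :
    (letterSpan u w k).Normal := by
  have key : ∀ s ∈ S, ∀ x ∈ letterSpan u w k, s * x * s⁻¹ ∈ letterSpan u w k := by
    intro s hs x hx
    induction hx using Subgroup.closure_induction with
    | mem x hx =>
      obtain ⟨a, ha, rfl⟩ := hx
      have h1 : s * u a * s⁻¹ = ⁅s, u a⁆ * u a := by rw [commutatorElement_def]; group
      rw [h1]
      exact mul_mem (letterSpan_antitone (ha.trans (Nat.le_succ _)) (hstep s hs a))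
        (letterSpan_antitone ha (letter_mem a))
    | one => simp
    | mul x y _ _ hx hy =>
      have h1 : s * (x * y) * s⁻¹ = (s * x * s⁻¹) * (s * y * s⁻¹) := by group
      rw [h1]
      exact mul_mem hx hy
    | inv x _ hx =>
      have h1 : s * x⁻¹ * s⁻¹ = (s * x * s⁻¹)⁻¹ := by group
      rw [h1]
      exact inv_mem hx
  refine ⟨fun x hx g => ?_⟩
  obtain ⟨n, hn⟩ := hS.exists_mem_pow g
  induction n generalizing g x with
  | zero =>
    rw [pow_zero, Set.mem_one] at hn
    simpa [hn] using hx
  | succ n ih =>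
    rw [pow_succ] at hn
    obtain ⟨y, hy, s, hs, rfl⟩ := hn
    have h1 : y * s * x * (y * s)⁻¹ = y * (s * x * s⁻¹) * y⁻¹ := by group
    simp only [h1]
    exact ih _ (key s hs x hx) y hy

theorem commutator_top_letterSpan_le (hS : IsSymmGenSet S)
    (hstep : ∀ s ∈ S, ∀ a, ⁅s, u a⁆ ∈ letterSpan u w (w a + 1)) (k : ℕ) :
    ⁅(⊤ : Subgroup G), letterSpan u w k⁆ ≤ letterSpan u w (k + 1) := by
  have hN := letterSpan_normal hS hstep (k + 1)
  have key : ∀ s ∈ S, ∀ x ∈ letterSpan u w k, ⁅s, x⁆ ∈ letterSpan u w (k + 1) := by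
    intro s hs x hx
    induction hx using Subgroup.closure_induction with
    | mem x hx =>
      obtain ⟨a, ha, rfl⟩ := hx
      exact letterSpan_antitone (Nat.succ_le_succ ha) (hstep s hs a)
    | one => simp
    | mul x y _ _ hx hy =>
      have h1 : ⁅s, x * y⁆ = ⁅s, x⁆ * (x * ⁅s, y⁆ * x⁻¹) := by
        simp only [commutatorElement_def]; group
      rw [h1]
      exact mul_mem hx (hN.conj_mem _ hy _)
    | inv x _ hx =>
      rw [commutatorElement_inv_right, ← commutatorElement_inv]
      simpa using hN.conj_mem _ (inv_mem hx) x⁻¹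
  rw [Subgroup.commutator_le]
  intro g _ x hx
  obtain ⟨n, hn⟩ := hS.exists_mem_pow g
  induction n generalizing g with
  | zero =>
    rw [pow_zero, Set.mem_one] at hn
    simp [hn]
  | succ n ih =>
    rw [pow_succ] at hn
    obtain ⟨y, hy, s, hs, rfl⟩ := hn
    have h1 : ⁅y * s, x⁆ = y * ⁅s, x⁆ * y⁻¹ * ⁅y, x⁆ := by
      simp only [commutatorElement_def]; group
    simp only [h1]
    exact mul_mem (hN.conj_mem _ (key s hs x hx) _) (ih y trivial hy)

/-- As for the lower central series: induction on the second index `j`, writing the letters of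
weight at least `j + 1` as commutators and rotating with the three subgroups lemma. -/
theorem isWeightFiltration_of_step (hS : IsSymmGenSet S) (hpos : ∀ a, 1 ≤ w a)
    (hstep : ∀ s ∈ S, ∀ a, ⁅s, u a⁆ ∈ letterSpan u w (w a + 1))
    (hcomm : ∀ a, 2 ≤ w a → ∃ s ∈ S, ∃ b, w a = w b + 1 ∧ u a = ⁅s, u b⁆) :
    IsWeightFiltration u w := by
  have hN := letterSpan_normal hS hstep
  have htop := commutator_top_letterSpan_le hS hstep
  have key : ∀ j i, ⁅letterSpan u w i, letterSpan u w j⁆ ≤ letterSpan u w (i + j) := by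
    intro j
    induction j with
    | zero =>
      intro i
      have := hN i
      exact Subgroup.commutator_le_left _ _
    | succ j ih =>
      intro i
      rcases j.eq_zero_or_pos with rfl | hj
      · refine (Subgroup.commutator_comm_le _ _).trans (le_trans ?_ (htop i))
        exact Subgroup.commutator_mono le_top le_rfl
      -- Here `j ≥ 1` is essential: it gives weight at least `2`, so the letters are commutators.
      · have h1 : letterSpan u w (j + 1) ≤ ⁅(⊤ : Subgroup G), letterSpan u w j⁆ := by
          refine (Subgroup.closure_le _).2 ?_
          rintro _ ⟨a, ha, rfl⟩
          have ha' : j + 1 ≤ w a := ha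
          obtain ⟨s, -, b, hab, hs⟩ := hcomm a (by omega)
          rw [hs]
          exact Subgroup.commutator_mem_commutator trivial
            (letterSpan_antitone (by omega) (letter_mem b))
        refine (Subgroup.commutator_mono le_rfl h1).trans ?_
        refine (Subgroup.commutator_comm_le _ _).trans ?_
        have := hN (i + (j + 1))
        refine commutator_commutator_le_of_rotate ?_ ?_
        · refine (Subgroup.commutator_mono ((Subgroup.commutator_comm_le _ _).trans (ih i))
            le_rfl).trans ?_
          exact (Subgroup.commutator_comm_le _ _).trans (htop _)
        · refine (Subgroup.commutator_mono ((Subgroup.commutator_comm_le _ _).trans (htop i))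
            le_rfl).trans ((ih (i + 1)).trans ?_)
          exact letterSpan_antitone (by omega)
  exact ⟨hpos, fun i j x hx y hy => key j i (Subgroup.commutator_mem_commutator hx hy)⟩

/-- The iterated commutator `⁅tₖ, …, ⁅t₁, s⁆⁆`. -/
def iterComm (s : G) : List G → G
  | [] => s
  | t :: l => ⁅t, iterComm s l⁆

theorem iterComm_mem_lowerCentralSeries (s : G) (l : List G) :
    iterComm s l ∈ (⊤ : Subgroup G).lowerCentralSeries l.length := by
  induction l with
  | nil => trivial
  | cons t l ih =>
    rw [List.length_cons, Subgroup.lowerCentralSeries_succ, Subgroup.commutator_comm]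
    exact Subgroup.commutator_mem_commutator trivial ih

theorem hasBallCovering_of_isNilpotent (hG : Group.IsNilpotent G) (hS : IsSymmGenSet S) :
    HasBallCovering S := by
  obtain ⟨c, hc⟩ := Subgroup.nilpotent_iff_lowerCentralSeries.1 hG
  -- With `c + 1` in place of `c`, the letters of weight one exist even when `c = 0`.
  have hc' : (⊤ : Subgroup G).lowerCentralSeries (c + 1) = ⊥ :=
    le_bot_iff.1 (hc ▸ Subgroup.lowerCentralSeries_antitone _ (Nat.le_succ c))
  have := hS.finite.to_subtype
  let β := {l : List S // l.length < c + 1}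
  have : Finite β := (List.finite_length_lt S (c + 1)).to_subtype
  let u : S × β → G := fun p => iterComm (p.1 : G) (p.2.1.map (↑))
  let w : S × β → ℕ := fun p => p.2.1.length + 1
  have hcomm : ∀ a, 2 ≤ w a → ∃ s ∈ S, ∃ b, w a = w b + 1 ∧ u a = ⁅s, u b⁆ := by
    rintro ⟨s, l, hl⟩ h2
    cases l with
    | nil => simp [w] at h2
    | cons t l =>
      refine ⟨t, t.2, ⟨s, l, ?_⟩, rfl, rfl⟩
      simp only [List.length_cons] at hl
      omega
  have hstep : ∀ s ∈ S, ∀ a, ⁅s, u a⁆ ∈ letterSpan u w (w a + 1) := by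
    rintro t ht ⟨s, l, hl⟩
    by_cases h : (⟨t, ht⟩ :: l : List S).length < c + 1
    · exact letter_mem (u := u) (w := w) ⟨s, ⟨t, ht⟩ :: l, h⟩
    · have h1 := iterComm_mem_lowerCentralSeries (s : G) (t :: l.map (↑))
      have h2 : (t :: l.map ((↑) : S → G)).length = c + 1 := by
        simp only [List.length_cons, List.length_map] at *
        omega
      rw [h2, hc', Subgroup.mem_bot] at h1
      have h3 : ⁅t, u ⟨s, l, hl⟩⁆ = 1 := h1
      rw [h3]
      exact one_mem _
  have hu : IsLetterSystem S u w :=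
    { weightFiltration := isWeightFiltration_of_step hS (fun a => Nat.succ_pos _) hstep hcomm
      exists_letter := fun s hs => ⟨(⟨s, hs⟩, ⟨[], Nat.succ_pos c⟩), rfl, rfl⟩
      mem_of_weight := by
        rintro ⟨s, l, hl⟩ h1
        obtain rfl : l = [] := by simpa [w] using h1
        exact s.2
      eq_commutator := hcomm }
  exact hu.hasBallCovering hS

theorem HasBallCovering.iterate (hcov : HasBallCovering S) (j : ℕ) :
    ∃ K : ℕ, ∀ n : ℕ, 1 ≤ n → ∃ Y : Finset G, Y.card ≤ K ∧
      ∀ g ∈ S ^ (2 ^ j * n), ∃ y ∈ Y, y⁻¹ * g ∈ S ^ n := by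
  classical
  obtain ⟨K, hK⟩ := hcov
  induction j with
  | zero => exact ⟨1, fun n _ => ⟨{1}, by simp, fun g hg => ⟨1, by simp, by simpa using hg⟩⟩⟩
  | succ j ih =>
    obtain ⟨L, hL⟩ := ih
    refine ⟨L * K, fun n hn => ?_⟩
    obtain ⟨Y, hY, hYc⟩ := hL (2 * n) (by omega)
    obtain ⟨Z, hZ, hZc⟩ := hK n hn
    refine ⟨(Y ×ˢ Z).image fun p => p.1 * p.2, ?_, fun g hg => ?_⟩
    · refine Finset.card_image_le.trans ?_
      rw [Finset.card_product]
      gcongr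
    · obtain ⟨y, hy, hyg⟩ := hYc g (by rwa [← mul_assoc, ← pow_succ])
      obtain ⟨z, hz, hzg⟩ := hZc _ hyg
      exact ⟨y * z, Finset.mem_image.2 ⟨(y, z), Finset.mem_product.2 ⟨hy, hz⟩, rfl⟩,
        by rwa [mul_inv_rev, mul_assoc]⟩

/-- The elements of a subgroup `H` of the form `t * s * t'⁻¹` with `s ∈ S` and `t, t' ∈ T`. -/
def schreierSet (H : Subgroup G) (S T : Set G) : Set H := {h | (h : G) ∈ T * S * T⁻¹}

variable {H : Subgroup G} {T : Set G}

/-- Schreier rewriting: `h t s = h (t s t'⁻¹) t'`, where `t'` represents the coset of `t s`. Word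
length does not increase. -/
theorem exists_mem_schreierSet_pow (hT1 : (1 : G) ∈ T) (hT : ∀ g : G, ∃ t ∈ T, g * t⁻¹ ∈ H)
    {n : ℕ} {g : G} (hg : g ∈ S ^ n) : ∃ h ∈ schreierSet H S T ^ n, ∃ t ∈ T, g = h * t := by
  induction n generalizing g with
  | zero =>
    rw [pow_zero, Set.mem_one] at hg
    exact ⟨1, by simp, 1, hT1, by simp [hg]⟩
  | succ n ih =>
    rw [pow_succ] at hg
    obtain ⟨x, hx, s, hs, rfl⟩ := hg
    obtain ⟨h, hh, t, ht, rfl⟩ := ih hx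
    obtain ⟨t', ht', htt⟩ := hT (t * s)
    refine ⟨h * ⟨t * s * t'⁻¹, htt⟩, ?_, t', ht', ?_⟩
    · rw [pow_succ]
      exact Set.mul_mem_mul hh
        (Set.mul_mem_mul (Set.mul_mem_mul ht hs) (Set.inv_mem_inv.2 ht'))
    · simp [mul_assoc]

theorem isSymmGenSet_schreierSet (hS : IsSymmGenSet S) (hTf : T.Finite) (hT1 : (1 : G) ∈ T)
    (hT : ∀ g : G, ∃ t ∈ T, g * t⁻¹ ∈ H) : IsSymmGenSet (schreierSet H S T) where
  finite := ((hTf.mul hS.finite).mul hTf.inv).preimage Subtype.val_injective.injOn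
  one_mem := ⟨1, ⟨1, hT1, 1, hS.one_mem, by simp⟩, 1, by simpa using hT1, by simp⟩
  inv_mem := by
    rintro h ⟨_, ⟨t, ht, s, hs, rfl⟩, t', ht', h2⟩
    refine ⟨t'⁻¹ * s⁻¹, ⟨t'⁻¹, ht', s⁻¹, hS.inv_mem s hs, rfl⟩, t⁻¹, by simpa using ht, ?_⟩
    simp only at h2
    simp [← h2, mul_assoc]
  closure_eq_top := by
    refine (Subgroup.eq_top_iff' _).2 fun x => ?_
    have hpow : ∀ n, ∀ h ∈ schreierSet H S T ^ n, h ∈ Subgroup.closure (schreierSet H S T) := by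
      intro n
      induction n with
      | zero => intro h hh; rw [pow_zero, Set.mem_one] at hh; rw [hh]; exact one_mem _
      | succ n ih =>
        intro h hh
        rw [pow_succ] at hh
        obtain ⟨y, hy, z, hz, rfl⟩ := hh
        exact mul_mem (ih y hy) (Subgroup.subset_closure hz)
    obtain ⟨n, hn⟩ := hS.exists_mem_pow (x : G)
    obtain ⟨h, hh, t, ht, hxt⟩ := exists_mem_schreierSet_pow hT1 hT hn
    have htH : t ∈ H := by
      have : t = (h : G)⁻¹ * x := by rw [hxt]; group
      rw [this]
      exact mul_mem (inv_mem h.2) x.2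
    have h1 : x = h * ⟨t, htH⟩ := Subtype.ext hxt
    rw [h1]
    refine mul_mem (hpow n h hh) (Subgroup.subset_closure ?_)
    exact ⟨t * 1, ⟨t, ht, 1, hS.one_mem, rfl⟩, 1, by simpa using hT1, by simp⟩

theorem exists_finite_transversal (H : Subgroup G) [H.FiniteIndex] :
    ∃ T : Set G, T.Finite ∧ (1 : G) ∈ T ∧ ∀ g : G, ∃ t ∈ T, g * t⁻¹ ∈ H := by
  have : Finite (G ⧸ H) := H.finite_quotient_of_finiteIndex
  refine ⟨insert 1 (Set.range fun q : G ⧸ H => q.out⁻¹), (Set.finite_range _).insert 1,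
    Set.mem_insert _ _, fun g => ?_⟩
  refine ⟨_, Set.mem_insert_of_mem _ ⟨(g⁻¹ : G), rfl⟩, ?_⟩
  have := QuotientGroup.eq.1 (QuotientGroup.out_eq' ((g⁻¹ : G) : G ⧸ H)).symm
  simpa using this

theorem hasBallCovering_of_isVirtuallyNilpotent (hG : Group.IsVirtuallyNilpotent G)
    (hS : IsSymmGenSet S) : HasBallCovering S := by
  classical
  obtain ⟨H, hH, hfin⟩ := hG
  obtain ⟨T, hTf, hT1, hT⟩ := exists_finite_transversal H
  have hSH := isSymmGenSet_schreierSet hS hTf hT1 hT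
  have := hSH.finite.to_subtype
  have := hTf.to_subtype
  obtain ⟨C₁, hC₁⟩ := hS.exists_forall_mem_pow
    (fun h : schreierSet H S T => ((h : H) : G))
  obtain ⟨C₂, hC₂⟩ := hS.exists_forall_mem_pow (fun t : T => (t : G))
  set C := max (max C₁ C₂) 1 with hC
  have hC1 : 1 ≤ C := le_max_right _ _
  have hCS : ∀ m, ∀ h ∈ schreierSet H S T ^ m, (h : G) ∈ S ^ (C * m) := by
    intro m
    induction m with
    | zero =>
      intro h hh
      rw [pow_zero, Set.mem_one] at hh
      simp [hh]
    | succ m ih =>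
      intro h hh
      rw [pow_succ] at hh
      obtain ⟨y, hy, z, hz, rfl⟩ := hh
      exact hS.mul_mem_pow (ih y hy) (hC₁ ⟨z, hz⟩) (by
        rw [Nat.mul_succ]
        gcongr
        exact (le_max_left _ _).trans (le_max_left _ _))
  -- With `m = n / (2 * C) ≥ 1` one has `2 * n ≤ 8 * C * m ≤ 2 ^ (8 * C) * m`. Since `C * m ≤ n /
  -- 2`, there is room in `S ^ n` for the coset representative `t`, of length at most `C ≤ n / 2`.
  obtain ⟨K, hK⟩ := (hasBallCovering_of_isNilpotent hH hSH).iterate (8 * C)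
  refine ⟨max K (S ^ (4 * C)).ncard, fun n hn => ?_⟩
  rcases Nat.lt_or_ge n (2 * C) with hnC | hnC
  · refine ⟨(hS.finite_pow (4 * C)).toFinset, ?_, fun g hg => ⟨g, ?_, ?_⟩⟩
    · rw [← Set.ncard_eq_toFinset_card _ (hS.finite_pow (4 * C))]
      exact le_max_right _ _
    · rw [Set.Finite.mem_toFinset]
      exact hS.pow_mono (by omega) hg
    · rw [inv_mul_cancel]
      exact hS.one_mem_pow _
  · set m := n / (2 * C) with hm
    have hm1 : 1 ≤ m := (Nat.one_le_div_iff (by omega)).2 hnC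
    have hnm : 2 * n ≤ 2 ^ (8 * C) * m := by
      have h2 := Nat.div_add_mod n (2 * C)
      have h3 := Nat.mod_lt n (show 0 < 2 * C by omega)
      rw [← hm] at h2
      have h4 : 8 * C < 2 ^ (8 * C) := Nat.lt_two_pow_self
      have h5 : 8 * C * m ≤ 2 ^ (8 * C) * m := Nat.mul_le_mul_right _ h4.le
      nlinarith
    obtain ⟨Y, hY, hYc⟩ := hK m hm1
    refine ⟨Y.image (↑), (Finset.card_image_le.trans hY).trans (le_max_left _ _), fun g hg => ?_⟩
    obtain ⟨h, hh, t, ht, rfl⟩ := exists_mem_schreierSet_pow hT1 hT hg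
    obtain ⟨y, hy, hyh⟩ := hYc h (hSH.pow_mono hnm hh)
    refine ⟨y, Finset.mem_image_of_mem _ hy, ?_⟩
    have h1 : ((y : H) : G)⁻¹ * (h * t) = ((y⁻¹ * h : H) : G) * t := by simp [mul_assoc]
    rw [h1]
    refine hS.mul_mem_pow (hCS m _ hyh) (hC₂ ⟨t, ht⟩) ?_
    have h2 := Nat.mul_div_le n (2 * C)
    rw [← hm] at h2
    have h3 : C₂ ≤ C := (le_max_right _ _).trans (le_max_left _ _)
    nlinarith

end Nilpotent

/-! ### Geometry of the word metric -/

section Geometry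

open scoped Pointwise

variable {G : Type*} [Group G] {S : Set G}

theorem mem_pow_iff_list {n : ℕ} {x : G} :
    x ∈ S ^ n ↔ ∃ l : List G, (∀ s ∈ l, s ∈ S) ∧ l.length = n ∧ l.prod = x := by
  induction n generalizing x with
  | zero =>
    rw [pow_zero, Set.mem_one]
    constructor
    · rintro rfl
      exact ⟨[], by simp⟩
    · rintro ⟨l, -, h1, rfl⟩
      rw [List.length_eq_zero_iff.1 h1, List.prod_nil]
  | succ n ih =>
    rw [pow_succ']
    constructor
    · rintro ⟨s, hs, y, hy, rfl⟩
      obtain ⟨l, h1, h2, rfl⟩ := ih.1 hy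
      exact ⟨s :: l, by simpa using ⟨hs, h1⟩, by simp [h2], by simp⟩
    · rintro ⟨l, h1, h2, rfl⟩
      cases l with
      | nil => simp at h2
      | cons s l =>
        rw [List.prod_cons]
        exact Set.mul_mem_mul (h1 s (by simp))
          (ih.2 ⟨l, fun t ht => h1 t (by simp [ht]), by simpa using h2, rfl⟩)

namespace IsSymmGenSet

/-- Because `1 ∈ S`, the powers of `S` increase, so the least length decides membership in every
power. -/
theorem wordLength_le_iff (hS : IsSymmGenSet S) {x : G} {n : ℕ} :
    wordLength S x ≤ n ↔ x ∈ S ^ n := by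
  have h1 : wordLength S x = sInf {n : ℕ | x ∈ S ^ n} := by
    simp only [mem_pow_iff_list, wordLength]
  rw [h1]
  exact ⟨fun h => hS.pow_mono h (Nat.sInf_mem (s := {n : ℕ | x ∈ S ^ n}) (hS.exists_mem_pow x)),
    fun h => Nat.sInf_le h⟩

theorem mem_ball_iff (hS : IsSymmGenSet S) {g h : G} {n : ℕ} :
    h ∈ ball S g n ↔ g⁻¹ * h ∈ S ^ n :=
  hS.wordLength_le_iff

theorem wordDist_self (hS : IsSymmGenSet S) (x : G) : wordDist S x x = 0 := by
  rw [← Nat.le_zero, wordDist, hS.wordLength_le_iff]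
  simp

theorem wordDist_comm (hS : IsSymmGenSet S) (x y : G) : wordDist S x y = wordDist S y x := by
  have key : ∀ x y, wordDist S x y ≤ wordDist S y x := fun x y => by
    rw [wordDist, hS.wordLength_le_iff]
    have := hS.inv_mem_pow (hS.wordLength_le_iff.1 (le_refl (wordDist S y x)))
    simpa using this
  exact le_antisymm (key x y) (key y x)

theorem wordDist_triangle (hS : IsSymmGenSet S) (x y z : G) :
    wordDist S x z ≤ wordDist S x y + wordDist S y z := by
  rw [wordDist, hS.wordLength_le_iff]
  have := hS.mul_mem_pow (hS.wordLength_le_iff.1 (le_refl (wordDist S x y)))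
    (hS.wordLength_le_iff.1 (le_refl (wordDist S y z))) le_rfl
  simpa [mul_assoc] using this

theorem ball_eq (hS : IsSymmGenSet S) (g : G) (n : ℕ) : ball S g n = (g * ·) '' S ^ n := by
  ext h
  rw [hS.mem_ball_iff]
  constructor
  · intro hh
    exact ⟨_, hh, by simp⟩
  · rintro ⟨x, hx, rfl⟩
    simpa using hx

theorem finite_ball (hS : IsSymmGenSet S) (g : G) (n : ℕ) : (ball S g n).Finite := by
  rw [hS.ball_eq]
  exact (hS.finite_pow n).image _

end IsSymmGenSet

theorem HasBallCovering.ncard_pow_le (hcov : HasBallCovering S) (hS : IsSymmGenSet S) (j : ℕ) :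
    ∃ K : ℕ, ∀ n : ℕ, (S ^ (2 ^ j * n)).ncard ≤ K * (S ^ n).ncard := by
  classical
  obtain ⟨K, hK⟩ := hcov.iterate j
  refine ⟨max K 1, fun n => ?_⟩
  rcases n.eq_zero_or_pos with rfl | hn
  · rw [mul_zero]
    exact Nat.le_mul_of_pos_left _ (by simp)
  · obtain ⟨Y, hY, hYc⟩ := hK n hn
    have h1 : S ^ (2 ^ j * n) ⊆ (Y : Set G) * S ^ n := by
      intro g hg
      obtain ⟨y, hy, hyg⟩ := hYc g hg
      exact ⟨y, hy, _, hyg, by simp⟩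
    calc (S ^ (2 ^ j * n)).ncard ≤ ((Y : Set G) * S ^ n).ncard :=
          Set.ncard_le_ncard h1 (Y.finite_toSet.mul (hS.finite_pow n))
      _ ≤ (Y : Set G).ncard * (S ^ n).ncard := Set.natCard_mul_le
      _ ≤ max K 1 * (S ^ n).ncard := by
          rw [Set.ncard_coe_finset]
          gcongr
          exact hY.trans (le_max_left _ _)

/-- The annuli of width `h` and outer radii `n` and `n - h` are comparable. -/
theorem ncard_annulus_mul_le (hS : IsSymmGenSet S) {n h : ℕ} (hn : 5 * h ≤ n) :
    (S ^ n \ S ^ (n - h)).ncard * (S ^ h).ncard ≤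
      (S ^ (n - h) \ S ^ (n - 5 * h)).ncard * (S ^ (4 * h)).ncard := by
  classical
  have hf : ∀ a b : ℕ, (S ^ a \ S ^ b).Finite := fun a b => (hS.finite_pow a).sdiff
  -- Double counting: `p x` is `x` pulled inwards by `3 * h`. The ball of radius `h` about `p x`
  -- lies in the inner annulus, and every point of that ball is within `4 * h` of `x`.
  have hp : ∀ x : G, ∃ p : G, x ∈ S ^ n → p ∈ S ^ (n - 3 * h) ∧ p⁻¹ * x ∈ S ^ (3 * h) := by
    intro x
    by_cases hx : x ∈ S ^ n
    · have h1 : n = (n - 3 * h) + 3 * h := by omega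
      rw [h1, pow_add] at hx
      obtain ⟨p, hp, q, hq, rfl⟩ := hx
      exact ⟨p, fun _ => ⟨hp, by simpa using hq⟩⟩
    · exact ⟨1, fun h => absurd h hx⟩
  choose p hp using hp
  rw [Set.ncard_eq_toFinset_card _ (hf n (n - h)), Set.ncard_eq_toFinset_card _ (hf (n - h) _)]
  refine Finset.card_mul_le_card_mul (fun x v => (p x)⁻¹ * v ∈ S ^ h) ?_ ?_
  · intro x hx
    rw [Set.Finite.mem_toFinset] at hx
    obtain ⟨hp1, hp2⟩ := hp x hx.1
    rw [Set.ncard_eq_toFinset_card _ (hS.finite_pow h)]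
    refine Finset.card_le_card_of_injOn (p x * ·) ?_ (mul_right_injective (p x)).injOn
    intro s hs
    have hs' : s ∈ S ^ h := by simpa using hs
    rw [Finset.mem_coe, Finset.mem_bipartiteAbove, Set.Finite.mem_toFinset]
    refine ⟨⟨hS.mul_mem_pow hp1 hs' (by omega), fun hv => hx.2 ?_⟩, by simpa using hs'⟩
    have h2 := hS.mul_mem_pow (hS.mul_mem_pow hv (hS.inv_mem_pow hs') le_rfl) hp2
      (k := n - h) (by omega)
    simpa using h2
  · intro v hv
    rw [← Set.ncard_coe_finset]
    refine (Set.ncard_le_ncard (t := (v * ·) '' S ^ (4 * h)) ?_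
      ((hS.finite_pow _).image _)).trans (Set.ncard_image_le (hS.finite_pow _))
    intro x hx
    rw [Finset.mem_coe, Finset.mem_bipartiteBelow, Set.Finite.mem_toFinset] at hx
    obtain ⟨hx, hpv⟩ := hx
    refine ⟨v⁻¹ * x, ?_, by simp⟩
    have h2 := hS.mul_mem_pow (hS.inv_mem_pow hpv) (hp x hx.1).2 (k := 4 * h) (by omega)
    simpa [mul_assoc] using h2

/-- Annuli of small relative width have small relative size. -/
theorem HasBallCovering.exists_ncard_annulus_le (hcov : HasBallCovering S) (hS : IsSymmGenSet S)
    {ε : ℝ} (hε : 0 < ε) : ∃ j : ℕ, 1 ≤ j ∧ ∀ n : ℕ,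
      ((S ^ n \ S ^ (n - n / j)).ncard : ℝ) ≤ ε * (S ^ n).ncard := by
  obtain ⟨K, hK⟩ := hcov.ncard_pow_le hS 2
  -- The next annulus has at least `1 / K` times the size of the outer one, so the outer one is at
  -- most the fraction `K / (K + 1)` of their union.
  have hstep : ∀ n h : ℕ, 5 * h ≤ n →
      (K + 1) * (S ^ n \ S ^ (n - h)).ncard ≤ K * (S ^ n \ S ^ (n - 5 * h)).ncard := by
    intro n h hn
    have h1 := ncard_annulus_mul_le hS hn
    have h2 : (S ^ (4 * h)).ncard ≤ K * (S ^ h).ncard := by simpa using hK h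
    have h3 : 0 < (S ^ h).ncard := (Set.ncard_pos (hS.finite_pow h)).2 ⟨1, hS.one_mem_pow h⟩
    have h4 : (S ^ n \ S ^ (n - h)).ncard ≤ K * (S ^ (n - h) \ S ^ (n - 5 * h)).ncard := by
      refine Nat.le_of_mul_le_mul_right (h1.trans ?_) h3
      calc _ ≤ (S ^ (n - h) \ S ^ (n - 5 * h)).ncard * (K * (S ^ h).ncard) := by gcongr
        _ = _ := by ring
    have h5 : S ^ n \ S ^ (n - 5 * h) =
        (S ^ n \ S ^ (n - h)) ∪ (S ^ (n - h) \ S ^ (n - 5 * h)) := by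
      rw [Set.sdiff_union_sdiff_cancel (hS.pow_mono (Nat.sub_le _ _)) (hS.pow_mono (by omega))]
    rw [h5, Set.ncard_union_eq ?_ (hS.finite_pow _).sdiff (hS.finite_pow _).sdiff]
    · nlinarith
    · exact Set.disjoint_left.2 fun x hx hx' => hx.2 hx'.1
  have hdecay : ∀ i n : ℕ, ((S ^ n \ S ^ (n - n / 5 ^ i)).ncard : ℝ) ≤
      ((K : ℝ) / (K + 1)) ^ i * (S ^ n).ncard := by
    intro i n
    induction i with
    | zero =>
      simp only [pow_zero, one_mul]
      exact_mod_cast Set.ncard_le_ncard Set.sdiff_subset (hS.finite_pow n)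
    | succ i ih =>
      have h0 : 5 * (n / 5 ^ (i + 1)) ≤ n / 5 ^ i := by
        rw [pow_succ, ← Nat.div_div_eq_div_mul]
        exact Nat.mul_div_le _ _
      have h1 := hstep n (n / 5 ^ (i + 1)) (h0.trans (Nat.div_le_self _ _))
      have h2 : (S ^ n \ S ^ (n - 5 * (n / 5 ^ (i + 1)))).ncard ≤
          (S ^ n \ S ^ (n - n / 5 ^ i)).ncard :=
        Set.ncard_le_ncard (Set.sdiff_subset_sdiff_right (hS.pow_mono (by omega)))
          (hS.finite_pow n).sdiff
      have h3 : ((K : ℝ) + 1) * (S ^ n \ S ^ (n - n / 5 ^ (i + 1))).ncard ≤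
          K * (S ^ n \ S ^ (n - n / 5 ^ i)).ncard := by
        exact_mod_cast h1.trans (Nat.mul_le_mul_left _ h2)
      calc ((S ^ n \ S ^ (n - n / 5 ^ (i + 1))).ncard : ℝ)
          ≤ (K : ℝ) / (K + 1) * (S ^ n \ S ^ (n - n / 5 ^ i)).ncard := by
            rw [div_mul_eq_mul_div, le_div_iff₀ (by positivity)]
            linarith
        _ ≤ (K : ℝ) / (K + 1) * (((K : ℝ) / (K + 1)) ^ i * (S ^ n).ncard) := by gcongr
        _ = _ := by ring
  obtain ⟨i, hi⟩ := exists_pow_lt_of_lt_one hε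
    (show (K : ℝ) / (K + 1) < 1 by rw [div_lt_one (by positivity)]; linarith)
  exact ⟨5 ^ i, Nat.one_le_pow _ _ (by norm_num), fun n =>
    (hdecay i n).trans (by gcongr)⟩

theorem HasBallCovering.exists_ncard_ball_diff_le (hcov : HasBallCovering S)
    (hS : IsSymmGenSet S) {ε : ℝ} (hε : 0 < ε) : ∃ j : ℕ, 1 ≤ j ∧ ∀ (g : G) (n : ℕ),
      ((ball S g n \ ball S g (n - n / j)).ncard : ℝ) ≤ ε * (ball S g n).ncard := by
  obtain ⟨j, hj, h⟩ := hcov.exists_ncard_annulus_le hS hε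
  refine ⟨j, hj, fun g n => ?_⟩
  have hinj : Function.Injective (g * ·) := mul_right_injective g
  rw [hS.ball_eq, hS.ball_eq, ← Set.image_sdiff hinj, Set.ncard_image_of_injective _ hinj,
    Set.ncard_image_of_injective _ hinj]
  exact h n

/-- Balls of radius `n` are covered by boundedly many balls of radius `n / k`. -/
theorem HasBallCovering.exists_cover_ball (hcov : HasBallCovering S) (hS : IsSymmGenSet S)
    {k : ℕ} (hk : 1 ≤ k) : ∃ K : ℕ, ∀ (g : G) (n : ℕ), ∃ y : Fin K → G, ∀ x ∈ ball S g n,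
      ∃ i, x ∈ ball S (y i) (n / k) := by
  suffices H : ∃ K : ℕ, ∀ n : ℕ, ∃ Y : Finset G, Y.card ≤ K ∧
      ∀ g ∈ S ^ n, ∃ y ∈ Y, y⁻¹ * g ∈ S ^ (n / k) by
    obtain ⟨K, hK⟩ := H
    refine ⟨K, fun g n => ?_⟩
    obtain ⟨Y, hY, hYc⟩ := hK n
    -- The surplus indices receive the irrelevant centre `1`, so that the family has length `K` for
    -- all `g` and `n`.
    refine ⟨fun i => if h : (i : ℕ) < Y.card then g * Y.equivFin.symm ⟨i, h⟩ else 1,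
      fun x hx => ?_⟩
    obtain ⟨y, hy, hyx⟩ := hYc _ (hS.mem_ball_iff.1 hx)
    refine ⟨⟨Y.equivFin ⟨y, hy⟩, (Fin.is_lt _).trans_le hY⟩, ?_⟩
    rw [hS.mem_ball_iff]
    simpa [mul_assoc] using hyx
  obtain ⟨K, hK⟩ := hcov.iterate (2 * k)
  refine ⟨max K (S ^ k).ncard, fun n => ?_⟩
  rcases Nat.lt_or_ge n k with hnk | hnk
  · refine ⟨(hS.finite_pow k).toFinset, ?_, fun g hg => ⟨g, ?_, ?_⟩⟩
    · rw [← Set.ncard_eq_toFinset_card _ (hS.finite_pow k)]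
      exact le_max_right _ _
    · rw [Set.Finite.mem_toFinset]
      exact hS.pow_mono hnk.le hg
    · rw [inv_mul_cancel]
      exact hS.one_mem_pow _
  · have hm1 : 1 ≤ n / k := (Nat.one_le_div_iff (by omega)).2 hnk
    obtain ⟨Y, hY, hYc⟩ := hK (n / k) hm1
    refine ⟨Y, hY.trans (le_max_left _ _), fun g hg => hYc g (hS.pow_mono ?_ hg)⟩
    have h2 := Nat.div_add_mod n k
    have h3 := Nat.mod_lt n hk
    have h4 : 2 * k < 2 ^ (2 * k) := Nat.lt_two_pow_self
    have h5 : 2 * k * (n / k) ≤ 2 ^ (2 * k) * (n / k) := Nat.mul_le_mul_right _ h4.le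
    nlinarith

end Geometry

/-! ### Internal sets and Loeb measures -/

section Loeb

open ArchimedeanClass

variable {ι : Type*} {𝓤 : Ultrafilter ι} {X : Type*}

theorem toSet_subset_of_eventually {A B : ι → Set X} (h : ∀ᶠ i in (𝓤 : Filter ι), A i ⊆ B i) :
    toSet (A : NS 𝓤 (Set X)) ⊆ toSet (B : NS 𝓤 (Set X)) := by
  intro x
  induction x using Germ.inductionOn with
  | h f =>
    intro hx
    have hx' : ∀ᶠ i in (𝓤 : Filter ι), f i ∈ A i := hx
    have : ∀ᶠ i in (𝓤 : Filter ι), f i ∈ B i := by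
      filter_upwards [h, hx'] with i h1 h2 using h1 h2
    exact this

theorem eventually_inter_subset {A B C : ι → Set X}
    (h : toSet (A : NS 𝓤 (Set X)) ∩ toSet (B : NS 𝓤 (Set X)) ⊆ toSet (C : NS 𝓤 (Set X))) :
    ∀ᶠ i in (𝓤 : Filter ι), A i ∩ B i ⊆ C i := by
  by_contra hcon
  rw [← Ultrafilter.eventually_not] at hcon
  obtain ⟨i₀, hi₀⟩ := hcon.exists
  obtain ⟨x₀, -⟩ := Set.not_subset.1 hi₀
  have hx : ∀ i, ∃ x, ¬ A i ∩ B i ⊆ C i → x ∈ A i ∩ B i ∧ x ∉ C i := by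
    intro i
    by_cases hi : A i ∩ B i ⊆ C i
    · exact ⟨x₀, fun h => absurd hi h⟩
    · obtain ⟨x, hx⟩ := Set.not_subset.1 hi
      exact ⟨x, fun _ => hx⟩
  choose f hf using hx
  have h1 : ∀ᶠ i in (𝓤 : Filter ι), f i ∈ A i := hcon.mono fun i hi => (hf i hi).1.1
  have h2 : ∀ᶠ i in (𝓤 : Filter ι), f i ∈ B i := hcon.mono fun i hi => (hf i hi).1.2
  have h3 : ∀ᶠ i in (𝓤 : Filter ι), f i ∈ C i := h (show (f : NS 𝓤 X) ∈ _ from ⟨h1, h2⟩)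
  obtain ⟨i, h4, h5⟩ := (h3.and hcon).exists
  exact (hf i h5).2 h4

theorem toSet_map₂_inter (A B : NS 𝓤 (Set X)) :
    toSet (Germ.map₂ (fun a b : Set X => a ∩ b) A B) = toSet A ∩ toSet B := by
  ext x
  induction A using Germ.inductionOn
  induction B using Germ.inductionOn
  induction x using Germ.inductionOn
  exact eventually_and

theorem toSet_map₂_diff (A B : NS 𝓤 (Set X)) :
    toSet (Germ.map₂ (fun a b : Set X => a \ b) A B) = toSet A \ toSet B := by
  ext x
  induction A using Germ.inductionOn
  induction B using Germ.inductionOn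
  induction x using Germ.inductionOn
  exact eventually_and.trans (and_congr Iff.rfl Ultrafilter.eventually_not)

/-- The embedding of the real numbers in the hyperreal numbers. -/
def realEmbedding (𝓤 : Ultrafilter ι) : ℝ →+*o NS 𝓤 ℝ where
  toFun r := (r : NS 𝓤 ℝ)
  map_zero' := rfl
  map_one' := rfl
  map_add' _ _ := rfl
  map_mul' _ _ := rfl
  monotone' _ _ h := Germ.const_le_iff.2 h

/-- A nonnegative class means a finite hyperreal; the additivity and monotonicity of `stdPart` are
used for such elements. -/
theorem mk_nonneg_of_bounded {f : ι → ℝ} (h0 : ∀ i, 0 ≤ f i) (h1 : ∀ i, f i ≤ 1) :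
    0 ≤ ArchimedeanClass.mk (f : NS 𝓤 ℝ) :=
  mk_nonneg_of_le_of_le_of_archimedean (realEmbedding 𝓤) (r := 0) (s := 1)
    (Germ.coe_le.2 (Eventually.of_forall h0)) (Germ.coe_le.2 (Eventually.of_forall h1))

/-- The relative size of `C` in `I`. -/
def density (I C : Set X) : ℝ := ((C ∩ I).ncard : ℝ) / (I.ncard : ℝ)

theorem density_nonneg (I C : Set X) : 0 ≤ density I C := by unfold density; positivity

theorem density_le_one (I C : Set X) : density I C ≤ 1 := by
  rcases I.finite_or_infinite with h | h
  · refine div_le_one_of_le₀ ?_ (Nat.cast_nonneg _)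
    exact_mod_cast Set.ncard_le_ncard Set.inter_subset_right h
  · simp [density, h.ncard]

theorem density_inter_add_diff (I C D : Set X) :
    density I (C ∩ D) + density I (C \ D) = density I C := by
  rcases I.finite_or_infinite with h | h
  · unfold density
    rw [← add_div, ← Set.ncard_inter_add_ncard_sdiff_eq_ncard (C ∩ I) D (h.inter_of_right C)]
    push_cast
    congr 4
    · ext; simp only [Set.mem_inter_iff]; tauto
    · ext; simp only [Set.mem_inter_iff, Set.mem_sdiff]; tauto
  · simp [density, h.ncard]

theorem mk_density_nonneg (I C : ι → Set X) :
    0 ≤ ArchimedeanClass.mk ((fun i => density (I i) (C i) : ι → ℝ) : NS 𝓤 ℝ) :=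
  mk_nonneg_of_bounded (fun _ => density_nonneg _ _) (fun _ => density_le_one _ _)

theorem loebContent_coe (I C : ι → Set X) :
    loebContent (I : NS 𝓤 (Set X)) (C : NS 𝓤 (Set X)) =
      ENNReal.ofReal (stdPart ((fun i => density (I i) (C i) : ι → ℝ) : NS 𝓤 ℝ)) := rfl

theorem loebContent_inter_add_diff (I C D : NS 𝓤 (Set X)) :
    loebContent I (Germ.map₂ (fun a b : Set X => a ∩ b) C D) +
      loebContent I (Germ.map₂ (fun a b : Set X => a \ b) C D) = loebContent I C := by
  induction I using Germ.inductionOn with | h I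
  induction C using Germ.inductionOn with | h C
  induction D using Germ.inductionOn with | h D
  rw [Germ.map₂_coe, Germ.map₂_coe, loebContent_coe, loebContent_coe, loebContent_coe,
    ← ENNReal.ofReal_add, ← stdPart_add (mk_density_nonneg _ _) (mk_density_nonneg _ _)]
  · congr 2
    change ((fun i => density (I i) (C i ∩ D i) + density (I i) (C i \ D i) : ι → ℝ) : NS 𝓤 ℝ) = _
    simp only [density_inter_add_diff]
  · exact stdPart_nonneg (Germ.coe_le.2 (Eventually.of_forall fun i => density_nonneg _ _))
  · exact stdPart_nonneg (Germ.coe_le.2 (Eventually.of_forall fun i => density_nonneg _ _))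

theorem loebContent_le_of_density_le {I J C D : ι → Set X}
    (h : ∀ᶠ i in (𝓤 : Filter ι), density (I i) (C i) ≤ density (J i) (D i)) :
    loebContent (I : NS 𝓤 (Set X)) (C : NS 𝓤 (Set X)) ≤
      loebContent (J : NS 𝓤 (Set X)) (D : NS 𝓤 (Set X)) := by
  rw [loebContent_coe, loebContent_coe]
  exact ENNReal.ofReal_le_ofReal
    (stdPart_monotoneOn (mk_density_nonneg _ _) (mk_density_nonneg _ _) (Germ.coe_le.2 h))

theorem loebContent_le_ofReal {I C : ι → Set X} {ε : ℝ}
    (h : ∀ᶠ i in (𝓤 : Filter ι), density (I i) (C i) ≤ ε) :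
    loebContent (I : NS 𝓤 (Set X)) (C : NS 𝓤 (Set X)) ≤ ENNReal.ofReal ε := by
  rw [loebContent_coe]
  exact ENNReal.ofReal_le_ofReal
    (stdPart_le_of_le (realEmbedding 𝓤) (mk_density_nonneg _ _) (Germ.coe_le.2 h))

theorem loebContentSet_toSet_le (I C : NS 𝓤 (Set X)) :
    loebContentSet I (toSet C) ≤ loebContent I C :=
  iInf₂_le (f := fun C' (_ : toSet C' = toSet C) => loebContent I C') C rfl

theorem loebOuter_toSet_le (I C : NS 𝓤 (Set X)) : loebOuter I (toSet C) ≤ loebContent I C :=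
  (OuterMeasure.ofFunction_le _).trans (loebContentSet_toSet_le I C)

theorem measurableSet_toSet (I D : NS 𝓤 (Set X)) :
    MeasurableSet[(loebOuter I).caratheodory] (toSet D) := by
  refine OuterMeasure.ofFunction_caratheodory fun t => le_iInf₂ fun C hC => ?_
  rw [← hC, ← loebContent_inter_add_diff I C D, ← toSet_map₂_inter, ← toSet_map₂_diff]
  exact add_le_add (loebContentSet_toSet_le _ _) (loebContentSet_toSet_le _ _)

/-- The covers that define the outer measure consist of internal sets, which are measurable. Hence
the measure of an arbitrary set is its outer measure, and no near set has to be shown measurable. -/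
theorem loebMeasure_eq_loebOuter (I : NS 𝓤 (Set X)) (E : Set (NS 𝓤 X)) :
    loebMeasure I E = loebOuter I E := by
  refine le_antisymm (le_iInf₂ fun t ht => ?_)
    (@le_toMeasure_apply _ (loebOuter I).caratheodory (loebOuter I) le_rfl E)
  refine (measure_mono ht).trans ((measure_iUnion_le t).trans (ENNReal.tsum_le_tsum fun n => ?_))
  refine le_iInf₂ fun C hC => ?_
  rw [← hC]
  refine le_trans (le_of_eq ?_) (loebOuter_toSet_le I C)
  exact @toMeasure_apply _ (loebOuter I).caratheodory (loebOuter I) le_rfl _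
    (measurableSet_toSet I C)

theorem loebMeasure_toSet_le (I C : NS 𝓤 (Set X)) : loebMeasure I (toSet C) ≤ loebContent I C :=
  (loebMeasure_eq_loebOuter I _).trans_le (loebOuter_toSet_le I C)

/-- On subsets of the smaller set, the Loeb measure of a hyperfinite set is bounded by the Loeb
measure of a smaller hyperfinite set. -/
theorem loebMeasure_le_of_subset {I J : ι → Set X} (hI : ∀ i, (I i).Finite)
    (hJI : ∀ᶠ i in (𝓤 : Filter ι), J i ⊆ I i) {E : Set (NS 𝓤 X)}
    (hE : E ⊆ toSet (J : NS 𝓤 (Set X))) :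
    loebMeasure (I : NS 𝓤 (Set X)) E ≤ loebMeasure (J : NS 𝓤 (Set X)) E := by
  rw [loebMeasure_eq_loebOuter, loebMeasure_eq_loebOuter]
  refine le_iInf₂ fun t ht => ?_
  -- Members of a cover may be cut down to `J`; then passing from `I` to `J` only decreases the
  -- denominator of the density.
  have h1 : E ⊆ ⋃ n, t n ∩ toSet (J : NS 𝓤 (Set X)) := by
    rw [← Set.iUnion_inter]
    exact Set.subset_inter ht hE
  refine (measure_mono h1).trans ((measure_iUnion_le _).trans (ENNReal.tsum_le_tsum fun n => ?_))
  refine le_iInf₂ fun C hC => ?_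
  rw [← hC]
  induction C using Germ.inductionOn with | h C
  rw [← toSet_map₂_inter, Germ.map₂_coe]
  refine (loebOuter_toSet_le _ _).trans (loebContent_le_of_density_le ?_)
  filter_upwards [hJI] with i hi
  unfold density
  rw [Set.inter_assoc, Set.inter_eq_left.2 hi]
  rcases (J i).eq_empty_or_nonempty with h | h
  · simp [h]
  · have h2 : 0 < (J i).ncard := (Set.ncard_pos ((hI i).subset hi)).2 h
    have h3 : (J i).ncard ≤ (I i).ncard := Set.ncard_le_ncard hi (hI i)
    gcongr

end Loeb

/-! ### Hyperfinite balls -/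

section Hyperfinite

variable {ι : Type*} {𝓤 : Ultrafilter ι} {G : Type*} [Group G] {S : Set G}

theorem isInfinite_coe {N : ι → ℕ} :
    IsInfinite (N : NS 𝓤 ℕ) ↔ ∀ n : ℕ, ∀ᶠ i in (𝓤 : Filter ι), n ≤ N i := by
  constructor
  · intro h n
    have h1 : ∀ m : ℕ, ∀ᶠ i in (𝓤 : Filter ι), N i ≠ m := by
      intro m
      rw [Ultrafilter.eventually_not]
      exact fun h2 => h m (Germ.coe_eq.2 h2)
    induction n with
    | zero => exact Eventually.of_forall fun i => Nat.zero_le _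
    | succ n ih =>
      filter_upwards [ih, h1 n] with i h2 h3
      omega
  · intro h n hn
    have h1 : ∀ᶠ i in (𝓤 : Filter ι), N i = n := Germ.coe_eq.1 hn
    obtain ⟨i, h2, h3⟩ := (h1.and (h (n + 1))).exists
    omega

theorem mem_eqClass_coe {N : ι → ℕ} (hN : IsInfinite (N : NS 𝓤 ℕ)) {x y : ι → G} :
    (y : NS 𝓤 G) ∈ eqClass S (N : NS 𝓤 ℕ) (x : NS 𝓤 G) ↔
      ∀ k : ℕ, ∀ᶠ i in (𝓤 : Filter ι), k * wordDist S (x i) (y i) ≤ N i := by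
  rw [isInfinite_coe] at hN
  have h1 : ∀ ε : ℝ, nsDist S (x : NS 𝓤 G) (y : NS 𝓤 G) / natToReal (N : NS 𝓤 ℕ) < (ε : NS 𝓤 ℝ) ↔
      ∀ᶠ i in (𝓤 : Filter ι), (wordDist S (x i) (y i) : ℝ) / N i < ε := fun ε => Germ.coe_lt
  simp only [eqClass, Set.mem_ofPred_eq, h1]
  constructor
  · intro h k
    filter_upwards [h (1 / (k + 1)) (by positivity), hN 1] with i h2 h3
    have h3' : (0 : ℝ) < N i := by exact_mod_cast h3
    rw [div_lt_iff₀ h3', one_div, inv_mul_eq_div, lt_div_iff₀ (by positivity)] at h2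
    have h4 : wordDist S (x i) (y i) * (k + 1) < N i := by exact_mod_cast h2
    nlinarith
  · intro h ε hε
    obtain ⟨k, hk⟩ := exists_nat_gt (1 / ε)
    filter_upwards [h k, hN 1] with i h2 h3
    have h3' : (0 : ℝ) < N i := by exact_mod_cast h3
    have h2' : (k : ℝ) * wordDist S (x i) (y i) ≤ N i := by exact_mod_cast h2
    rw [div_lt_iff₀ hε] at hk
    rw [div_lt_iff₀ h3']
    have hk0 : (0 : ℝ) < k := by
      rcases Nat.eq_zero_or_pos k with rfl | h
      · norm_num at hk
      · exact_mod_cast h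
    nlinarith

/-- The points of the ball `B(g, N)` that are infinitely close, at the scale `N`, to a point of
`A` in the ball. -/
def nearSet (S : Set G) (A : NS 𝓤 (Set G)) (g : NS 𝓤 G) (N : NS 𝓤 ℕ) : Set (NS 𝓤 G) :=
  {x | x ∈ toSet (nsBall S g N) ∧ ∃ a ∈ toSet A ∩ toSet (nsBall S g N), a ∈ eqClass S N x}

/-- Infinite closeness is an equivalence relation, so two classes agree exactly when one point lies
in the class of the other. -/
theorem lam_eq (hS : IsSymmGenSet S) (A : NS 𝓤 (Set G)) (g : NS 𝓤 G) {N : NS 𝓤 ℕ}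
    (hN : IsInfinite N) : lam S A g N = loebMeasure (nsBall S g N) (nearSet S A g N) := by
  unfold lam coneMeasure
  congr 1
  induction N using Germ.inductionOn with | h N
  ext x
  rw [Set.inter_comm]
  refine and_congr_right fun _ => ⟨?_, ?_⟩
  · rintro ⟨a, ha, hax⟩
    refine ⟨a, ha, ?_⟩
    rw [← hax]
    induction a using Germ.inductionOn
    rw [mem_eqClass_coe hN]
    exact fun k => Eventually.of_forall fun i => by simp [hS.wordDist_self]
  · rintro ⟨a, ha, hax⟩
    refine ⟨a, ha, ?_⟩
    ext y
    induction a using Germ.inductionOn with | h a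
    induction x using Germ.inductionOn with | h x
    induction y using Germ.inductionOn with | h y
    rw [mem_eqClass_coe hN] at hax
    rw [mem_eqClass_coe hN, mem_eqClass_coe hN]
    constructor
    · intro h k
      filter_upwards [hax (2 * k), h (2 * k)] with i h1 h2
      have h3 := hS.wordDist_triangle (x i) (a i) (y i)
      nlinarith
    · intro h k
      filter_upwards [hax (2 * k), h (2 * k)] with i h1 h2
      have h3 := hS.wordDist_triangle (a i) (x i) (y i)
      rw [hS.wordDist_comm (a i) (x i)] at h3
      nlinarith

theorem isInfinite_div {N : ι → ℕ} (hN : IsInfinite (N : NS 𝓤 ℕ)) {p : ℕ} (hp : 1 ≤ p) :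
    IsInfinite ((fun i => N i / p : ι → ℕ) : NS 𝓤 ℕ) := by
  rw [isInfinite_coe] at *
  intro n
  filter_upwards [hN (n * p)] with i hi
  rwa [Nat.le_div_iff_mul_le hp]

/-- A point that is not infinitely close to `D ∩ I` has a ball of noninfinitesimal relative radius
around it that misses `D ∩ I`. -/
theorem exists_disjoint_ball_of_notMem_nearSet {D J : ι → Set G} {g y : ι → G} {M : ι → ℕ}
    (hM : IsInfinite (M : NS 𝓤 ℕ)) (hJ : (J : NS 𝓤 (Set G)) = nsBall S (g : NS 𝓤 G) (M : NS 𝓤 ℕ))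
    (hyJ : (y : NS 𝓤 G) ∈ toSet (nsBall S (g : NS 𝓤 G) (M : NS 𝓤 ℕ)))
    (hy : (y : NS 𝓤 G) ∉ nearSet S (D : NS 𝓤 (Set G)) (g : NS 𝓤 G) (M : NS 𝓤 ℕ)) (j : ℕ) :
    ∃ k : ℕ, Disjoint (toSet (D : NS 𝓤 (Set G)) ∩ toSet (J : NS 𝓤 (Set G)))
      (toSet (nsBall S (y : NS 𝓤 G) ((fun i => M i / (k + j) : ι → ℕ) : NS 𝓤 ℕ))) := by
  classical
  by_contra! hcon
  have hd : ∀ k : ℕ, ∀ᶠ i in (𝓤 : Filter ι), ∃ d, d ∈ D i ∩ J i ∧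
      wordDist S (y i) d ≤ M i / (k + j) := by
    intro k
    obtain ⟨d, hd, hd'⟩ := Set.not_disjoint_iff.1 (hcon k)
    induction d using Germ.inductionOn with | h d
    obtain ⟨hdD, hdJ⟩ := hd
    have h1 : ∀ᶠ i in (𝓤 : Filter ι), d i ∈ D i := hdD
    have h2 : ∀ᶠ i in (𝓤 : Filter ι), d i ∈ J i := hdJ
    have h3 : ∀ᶠ i in (𝓤 : Filter ι), wordDist S (y i) (d i) ≤ M i / (k + j) := hd'
    filter_upwards [h1, h2, h3] with i h1 h2 h3 using ⟨d i, ⟨h1, h2⟩, h3⟩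
  -- No saturation is needed: the nearest points, chosen index by index, form one `d` that satisfies
  -- the distance bounds for all standard `k` at once.
  have hmin : ∀ i, ∃ d : G, (D i ∩ J i).Nonempty →
      d ∈ D i ∩ J i ∧ ∀ e ∈ D i ∩ J i, wordDist S (y i) d ≤ wordDist S (y i) e := by
    intro i
    by_cases h : (D i ∩ J i).Nonempty
    · exact ⟨Function.argminOn (wordDist S (y i)) _ h, fun _ =>
        ⟨Function.argminOn_mem _ _ h, fun e he => Function.argminOn_le _ _ he⟩⟩
    · exact ⟨1, fun h' => absurd h' h⟩
  choose d hd' using hmin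
  have h1 : ∀ᶠ i in (𝓤 : Filter ι), d i ∈ D i :=
    (hd 0).mono fun i ⟨e, he, _⟩ => (hd' i ⟨e, he⟩).1.1
  have h2 : ∀ᶠ i in (𝓤 : Filter ι), d i ∈ J i :=
    (hd 0).mono fun i ⟨e, he, _⟩ => (hd' i ⟨e, he⟩).1.2
  refine hy ⟨hyJ, (d : NS 𝓤 G), ⟨h1, hJ ▸ h2⟩, (mem_eqClass_coe hM).2 fun k => ?_⟩
  filter_upwards [hd k] with i ⟨e, he, hei⟩
  have h3 := (hd' i ⟨e, he⟩).2 e he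
  have h4 := Nat.div_mul_le_self (M i) (k + j)
  calc k * wordDist S (y i) (d i) ≤ (k + j) * (M i / (k + j)) :=
        Nat.mul_le_mul (Nat.le_add_right _ _) (h3.trans hei)
    _ ≤ M i := Nat.mul_div_le _ _

/-- If `λ(D) < λ(A)` on a ball, then some smaller ball of infinite radius misses `D` and meets `A`
in a set of positive measure. -/
theorem exists_ball_disjoint_lam_pos (hS : IsSymmGenSet S) (hcov : HasBallCovering S)
    (D A : NS 𝓤 (Set G)) (g : NS 𝓤 G) {M : NS 𝓤 ℕ} (hM : IsInfinite M)
    (hlt : lam S D g M < lam S A g M) :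
    ∃ (h : NS 𝓤 G) (M' : NS 𝓤 ℕ), IsInfinite M' ∧
      toSet (nsBall S h M') ⊆ toSet (nsBall S g M) ∧
      Disjoint (toSet D) (toSet (nsBall S h M')) ∧ 0 < lam S A h M' := by
  rw [lam_eq hS _ _ hM, lam_eq hS _ _ hM] at hlt
  induction D using Germ.inductionOn with | h D
  induction A using Germ.inductionOn with | h A
  induction g using Germ.inductionOn with | h g
  induction M using Germ.inductionOn with | h M
  set J : ι → Set G := fun i => ball S (g i) (M i) with hJ
  have hJb : nsBall S (g : NS 𝓤 G) (M : NS 𝓤 ℕ) = (J : NS 𝓤 (Set G)) := rfl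
  have hJfin : ∀ i, (J i).Finite := fun i => hS.finite_ball _ _
  set XA := nearSet S (A : NS 𝓤 (Set G)) (g : NS 𝓤 G) (M : NS 𝓤 ℕ) with hXA
  set XD := nearSet S (D : NS 𝓤 (Set G)) (g : NS 𝓤 G) (M : NS 𝓤 ℕ) with hXD
  rw [hJb] at hlt
  set μ := loebMeasure (J : NS 𝓤 (Set G)) with hμ
  have hpos : 0 < μ (XA \ XD) := by
    by_contra hcon
    have h1 : μ XA ≤ μ XD + μ (XA \ XD) :=
      (measure_mono (by rw [Set.union_sdiff_self]; exact Set.subset_union_right)).trans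
        (measure_union_le _ _)
    rw [nonpos_iff_eq_zero.1 (not_lt.1 hcon), add_zero] at h1
    exact absurd hlt (not_lt.2 h1)
  -- As `ε` is strictly below the measure of `XA \ XD`, an annulus of measure at most `ε` cannot
  -- account for it.
  obtain ⟨ε, -, hε0, hεlt⟩ := ENNReal.lt_iff_exists_real_btwn.1 hpos
  have hε : 0 < ε := ENNReal.ofReal_pos.1 hε0
  obtain ⟨j, hj, hann⟩ := hcov.exists_ncard_ball_diff_le hS hε
  set inner : ι → Set G := fun i => ball S (g i) (M i - M i / j) with hinner
  set Ann : Set (NS 𝓤 G) := toSet (J : NS 𝓤 (Set G)) \ toSet (inner : NS 𝓤 (Set G)) with hAnn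
  have hAnnμ : μ Ann ≤ ENNReal.ofReal ε := by
    rw [hAnn, ← toSet_map₂_diff, Germ.map₂_coe]
    refine (loebMeasure_toSet_le _ _).trans (loebContent_le_ofReal (Eventually.of_forall fun i => ?_))
    unfold density
    rw [Set.inter_eq_left.2 Set.sdiff_subset]
    refine div_le_of_le_mul₀ (Nat.cast_nonneg _) hε.le (hann _ _)
  -- Adding `j` to the denominator makes the radius at most `M / j`, so these balls stay inside `J`.
  set E : ℕ → Set (NS 𝓤 G) := fun k => {y | y ∈ XA ∧ y ∈ toSet (inner : NS 𝓤 (Set G)) ∧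
    Disjoint (toSet (D : NS 𝓤 (Set G)) ∩ toSet (J : NS 𝓤 (Set G)))
      (toSet (nsBall S y ((fun i => M i / (k + j) : ι → ℕ) : NS 𝓤 ℕ)))} with hE
  have hsub : XA \ XD ⊆ Ann ∪ ⋃ k, E k := by
    rintro y ⟨hyA, hyD⟩
    by_cases hy : y ∈ toSet (inner : NS 𝓤 (Set G))
    · right
      induction y using Germ.inductionOn with | h y
      obtain ⟨k, hk⟩ := exists_disjoint_ball_of_notMem_nearSet hM hJb.symm hyA.1 hyD j
      exact Set.mem_iUnion.2 ⟨k, hyA, hy, hk⟩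
    · exact Or.inl ⟨hyA.1, hy⟩
  obtain ⟨k, hk⟩ : ∃ k, μ (E k) ≠ 0 := by
    by_contra! hcon
    have h1 := (measure_mono (μ := μ) hsub).trans (measure_union_le _ _)
    rw [measure_iUnion_null hcon, add_zero] at h1
    exact absurd (hεlt.trans_le (h1.trans hAnnμ)) (lt_irrefl _)
  set p := k + j with hp
  have hp1 : 1 ≤ p := by omega
  -- Two points of one piece are at distance at most `2 * (M / (4 * p))`, and a point of `A`
  -- infinitely close to one of them is within another `M / (4 * p)`. The factor `4` thus keeps
  -- these points of `A` inside the ball of radius `M / p`.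
  obtain ⟨K, hK⟩ := hcov.exists_cover_ball hS (k := 4 * p) (by omega)
  choose z hz using hK
  set Z : Fin K → Set (NS 𝓤 G) := fun l =>
    toSet ((fun i => ball S (z (g i) (M i) l) (M i / (4 * p)) : ι → Set G) : NS 𝓤 (Set G)) with hZ
  have hEZ : E k ⊆ ⋃ l, E k ∩ Z l := by
    intro y hy
    induction y using Germ.inductionOn with | h y
    have h1 : ∀ᶠ i in (𝓤 : Filter ι), y i ∈ J i := hy.1.1
    have h2 : ∃ l, ∀ᶠ i in (𝓤 : Filter ι), y i ∈ ball S (z (g i) (M i) l) (M i / (4 * p)) := by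
      by_contra! hcon
      obtain ⟨i, h4, h5⟩ := (h1.and (eventually_all.2 hcon)).exists
      obtain ⟨l, hl⟩ := hz (g i) (M i) (y i) h4
      exact h5 l hl
    obtain ⟨l, hl⟩ := h2
    exact Set.mem_iUnion.2 ⟨l, hy, hl⟩
  obtain ⟨l, hl⟩ : ∃ l, μ (E k ∩ Z l) ≠ 0 := by
    by_contra! hcon
    exact hk (measure_mono_null hEZ (measure_iUnion_null hcon))
  obtain ⟨y₀, hy₀, hy₀Z⟩ : (E k ∩ Z l).Nonempty := by
    by_contra hcon
    exact hl (by rw [Set.not_nonempty_iff_eq_empty.1 hcon, measure_empty])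
  induction y₀ using Germ.inductionOn with | h y₀
  set M' : ι → ℕ := fun i => M i / p with hM'
  have hM'inf : IsInfinite (M' : NS 𝓤 ℕ) := isInfinite_div hM hp1
  set J' : ι → Set G := fun i => ball S (y₀ i) (M' i) with hJ'
  have hJ'b : nsBall S (y₀ : NS 𝓤 G) (M' : NS 𝓤 ℕ) = (J' : NS 𝓤 (Set G)) := rfl
  have hin : ∀ᶠ i in (𝓤 : Filter ι), wordDist S (g i) (y₀ i) ≤ M i - M i / j := hy₀.2.1
  have hJJ : ∀ᶠ i in (𝓤 : Filter ι), J' i ⊆ J i := by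
    filter_upwards [hin] with i hi x hx
    have hx' : wordDist S (y₀ i) x ≤ M i / p := hx
    have h1 := hS.wordDist_triangle (g i) (y₀ i) x
    have h2 : M i / p ≤ M i / j := Nat.div_le_div_left (by omega) hj
    have h3 : M i / j ≤ M i := Nat.div_le_self _ _
    change wordDist S (g i) x ≤ M i
    omega
  have hJJs := toSet_subset_of_eventually hJJ
  have hmem : ∀ y ∈ E k ∩ Z l, y ∈ toSet (J' : NS 𝓤 (Set G)) ∧
      y ∈ nearSet S (A : NS 𝓤 (Set G)) (y₀ : NS 𝓤 G) (M' : NS 𝓤 ℕ) := by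
    rintro y ⟨⟨⟨-, a, ⟨haA, -⟩, hay⟩, -⟩, hyZ⟩
    induction y using Germ.inductionOn with | h y
    induction a using Germ.inductionOn with | h a
    rw [mem_eqClass_coe hM] at hay
    have h1 : ∀ᶠ i in (𝓤 : Filter ι), wordDist S (z (g i) (M i) l) (y i) ≤ M i / (4 * p) := hyZ
    have h2 : ∀ᶠ i in (𝓤 : Filter ι), wordDist S (z (g i) (M i) l) (y₀ i) ≤ M i / (4 * p) := hy₀Z
    have h4 : ∀ m, 4 * (m / (4 * p)) ≤ m / p := by
      intro m
      rw [mul_comm 4 p, ← Nat.div_div_eq_div_mul]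
      exact Nat.mul_div_le _ _
    have hd : ∀ᶠ i in (𝓤 : Filter ι), wordDist S (y₀ i) (y i) ≤ 2 * (M i / (4 * p)) := by
      filter_upwards [h1, h2] with i h1 h2
      have := hS.wordDist_triangle (y₀ i) (z (g i) (M i) l) (y i)
      rw [hS.wordDist_comm (y₀ i) (z (g i) (M i) l)] at this
      omega
    have hyJ' : (y : NS 𝓤 G) ∈ toSet (J' : NS 𝓤 (Set G)) := by
      have : ∀ᶠ i in (𝓤 : Filter ι), wordDist S (y₀ i) (y i) ≤ M i / p := by
        filter_upwards [hd] with i hd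
        have := h4 (M i)
        omega
      exact this
    refine ⟨hyJ', hyJ', (a : NS 𝓤 G), ⟨haA, ?_⟩, (mem_eqClass_coe hM'inf).2 fun m => ?_⟩
    · have : ∀ᶠ i in (𝓤 : Filter ι), wordDist S (y₀ i) (a i) ≤ M i / p := by
        filter_upwards [hd, hay (4 * p)] with i hd ha
        have h5 : wordDist S (y i) (a i) ≤ M i / (4 * p) := by
          rwa [Nat.le_div_iff_mul_le (by omega), mul_comm]
        have h6 := hS.wordDist_triangle (y₀ i) (y i) (a i)
        have := h4 (M i)
        omega
      exact this
    · filter_upwards [hay (m * p)] with i ha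
      change m * wordDist S (y i) (a i) ≤ M i / p
      rw [Nat.le_div_iff_mul_le (by omega)]
      linarith
  refine ⟨(y₀ : NS 𝓤 G), (M' : NS 𝓤 ℕ), hM'inf, hJJs, ?_, ?_⟩
  · rw [Set.disjoint_left]
    exact fun x hxD hxJ => Set.disjoint_left.1 hy₀.2.2 ⟨hxD, hJJs hxJ⟩ hxJ
  · rw [lam_eq hS _ _ hM'inf, hJ'b]
    calc 0 < μ (E k ∩ Z l) := pos_iff_ne_zero.2 hl
      _ ≤ loebMeasure (J' : NS 𝓤 (Set G)) (E k ∩ Z l) :=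
          loebMeasure_le_of_subset hJfin hJJ fun y hy => (hmem y hy).1
      _ ≤ _ := measure_mono fun y hy => (hmem y hy).2

/-- A ball inside `I` that misses `A` also misses `D`; the ratios are bounded by `1`, so the suprema
can be compared. -/
theorem gapRatio_le_gapRatio {I D A : Set G} (hI : I.Finite) (hDA : D ∩ I ⊆ A) :
    gapRatio S A I ≤ gapRatio S D I := by
  refine Real.sSup_le ?_ (Real.sSup_nonneg ?_)
  · rintro q ⟨x, m, hx, hxA, rfl⟩
    refine le_csSup ⟨1, ?_⟩ ⟨x, m, hx, ?_, rfl⟩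
    · rintro q ⟨y, n, hy, -, rfl⟩
      refine div_le_one_of_le₀ ?_ (Nat.cast_nonneg _)
      exact_mod_cast Set.ncard_le_ncard hy hI
    · rw [Set.eq_empty_iff_forall_notMem] at hxA ⊢
      exact fun y hy => hxA y ⟨hy.1, hDA ⟨hy.2, hx hy.1⟩⟩
  · rintro q ⟨x, m, -, -, rfl⟩
    positivity

theorem gap_le_gap (hS : IsSymmGenSet S) {D A : NS 𝓤 (Set G)} {g : NS 𝓤 G} {N : NS 𝓤 ℕ}
    (hDA : toSet D ∩ toSet (nsBall S g N) ⊆ toSet A) : gap S A g N ≤ gap S D g N := by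
  induction D using Germ.inductionOn with | h D
  induction A using Germ.inductionOn with | h A
  induction g using Germ.inductionOn with | h g
  induction N using Germ.inductionOn with | h N
  have h1 : ∀ᶠ i in (𝓤 : Filter ι), D i ∩ ball S (g i) (N i) ⊆ A i := eventually_inter_subset hDA
  refine Germ.coe_le.2 (h1.mono fun i hi => ?_)
  exact gapRatio_le_gapRatio (hS.finite_ball _ _) hi

theorem HasBM.mono {A : NS 𝓤 (Set G)} {g h : NS 𝓤 G} {N M : NS 𝓤 ℕ} (hA : HasBM S A g N)
    (hsub : toSet (nsBall S h M) ⊆ toSet (nsBall S g N)) : HasBM S A h M := by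
  intro ε hε
  obtain ⟨δ, hδ, H⟩ := hA ε hε
  exact ⟨δ, hδ, fun x P hP hPM => H x P hP (hPM.trans hsub)⟩

/-- Two inclusions replace the equality `A ∩ I = ⋃ B i`, because they survive the passage to a
smaller ball, where the `B i` may stick out. -/
theorem exists_hasEnhancedBM (hS : IsSymmGenSet S) (hcov : HasBallCovering S)
    (A : NS 𝓤 (Set G)) (n : ℕ) (g : NS 𝓤 G) (N : NS 𝓤 ℕ) (hN : IsInfinite N)
    (hA : HasEnhancedBM S A g N) (B : Fin n → NS 𝓤 (Set G))
    (hAB : toSet A ∩ toSet (nsBall S g N) ⊆ ⋃ i, toSet (B i))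
    (hBA : ∀ i, toSet (B i) ∩ toSet (nsBall S g N) ⊆ toSet A) :
    ∃ (i : Fin n) (h : NS 𝓤 G) (M : NS 𝓤 ℕ), IsInfinite M ∧
      toSet (nsBall S h M) ⊆ toSet (nsBall S g N) ∧ HasEnhancedBM S (B i) h M := by
  induction n generalizing g N with
  | zero =>
    have h1 : nearSet S A g N = ∅ := by
      refine Set.eq_empty_of_forall_notMem ?_
      rintro x ⟨-, a, ha, -⟩
      simpa using hAB ha
    have h2 := hA.2
    rw [lam_eq hS _ _ hN, h1, measure_empty] at h2
    exact absurd h2 (lt_irrefl _)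
  | succ n ih =>
    by_cases hB0 : HasEnhancedBM S (B 0) g N
    · exact ⟨0, g, N, hN, subset_rfl, hB0⟩
    obtain ⟨h, M, hM, hsub, hlt⟩ : ∃ (h : NS 𝓤 G) (M : NS 𝓤 ℕ), IsInfinite M ∧
        toSet (nsBall S h M) ⊆ toSet (nsBall S g N) ∧ lam S (B 0) h M < lam S A h M := by
      by_cases hBM : HasBM S (B 0) g N
      · have h1 : lam S (B 0) g N = 0 := by
          by_contra h2
          exact hB0 ⟨hBM, pos_iff_ne_zero.2 h2⟩
        exact ⟨g, N, hN, subset_rfl, h1 ▸ hA.2⟩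
      · unfold HasBM at hBM
        push Not at hBM
        obtain ⟨ε, hε, hfail⟩ := hBM
        obtain ⟨δ, hδ, hAδ⟩ := hA.1 ε hε
        obtain ⟨h, M, hM, hsub, hgap, hlam⟩ := hfail δ hδ
        refine ⟨h, M, hM, hsub, hlam.trans_le (hAδ h M hM hsub (le_trans ?_ hgap))⟩
        exact gap_le_gap hS ((Set.inter_subset_inter_right _ hsub).trans (hBA 0))
    obtain ⟨h', M', hM', hsub', hdisj, hpos⟩ :=
      exists_ball_disjoint_lam_pos hS hcov (B 0) A h hM hlt
    have hsub'' := hsub'.trans hsub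
    -- The new ball misses `B 0`, so the remaining `n` pieces cover `A` there.
    obtain ⟨i, x, P, hP, hPsub, hBi⟩ := ih h' M' hM' ⟨hA.1.mono hsub'', hpos⟩
      (fun i => B i.succ) (fun a ha => by
        obtain ⟨i, hi⟩ := Set.mem_iUnion.1 (hAB ⟨ha.1, hsub'' ha.2⟩)
        rcases Fin.eq_zero_or_eq_succ i with rfl | ⟨i, rfl⟩
        · exact absurd ha.2 (Set.disjoint_left.1 hdisj hi)
        · exact Set.mem_iUnion.2 ⟨i, hi⟩)
      (fun i => (Set.inter_subset_inter_right _ hsub'').trans (hBA i.succ))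
    exact ⟨i.succ, x, P, hP, hPsub.trans hsub'', hBi⟩

end Hyperfinite

end BallMeasure

end

theorem mainTheorem6 {ι : Type*} (𝓤 : Ultrafilter ι) {G : Type*} [Group G]
    (hG : Group.IsVirtuallyNilpotent G)
    (S : Set G) (hS : BallMeasure.IsSymmGenSet S) (hSS : BallMeasure.SmallSphereProperty S)
    (A : BallMeasure.NS 𝓤 (Set G)) (g : BallMeasure.NS 𝓤 G) (N : BallMeasure.NS 𝓤 ℕ)
    (hN : BallMeasure.IsInfinite N) (hA : BallMeasure.HasEnhancedBM S A g N)
    (n : ℕ) (B : Fin n → BallMeasure.NS 𝓤 (Set G))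
    (hB : BallMeasure.toSet A ∩ BallMeasure.toSet (BallMeasure.nsBall S g N) =
      ⋃ i, BallMeasure.toSet (B i)) :
    ∃ (i : Fin n) (h : BallMeasure.NS 𝓤 G) (M : BallMeasure.NS 𝓤 ℕ),
      BallMeasure.IsInfinite M ∧
      BallMeasure.toSet (BallMeasure.nsBall S h M) ⊆
        BallMeasure.toSet (BallMeasure.nsBall S g N) ∧
      BallMeasure.HasEnhancedBM S (B i) h M :=
  BallMeasure.exists_hasEnhancedBM hS
    (BallMeasure.hasBallCovering_of_isVirtuallyNilpotent hG hS) A n g N hN hA B hB.subset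
    fun i => Set.inter_subset_left.trans
      ((Set.subset_iUnion (fun i => BallMeasure.toSet (B i)) i).trans
        (hB.symm.subset.trans Set.inter_subset_left))
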